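/- Let $\Omega\subset\mathbb R^3$ be bounded and open, $\omega,c>0$, $\chi_0\in\mathbb R$, let $\sigma$ be the surface measure of $\mathbb S^2$, and let $\mathbb S^2_*=\{\theta\in\mathbb S^2:\theta_1\ne\theta_2,\ \theta_3>0\}$. For $\theta\in\mathbb S^2$ put $v=v(\theta)=\frac\omega c(\theta+e_3)$ and $P_\theta=\mathbb 1-\theta\theta^T$. For $f\in L^2(\Omega)$ let $\tilde f(k)=\int_\Omega f(x)e^{-i\langle k,x\rangle}dx$. *Operators.* Let $G(x)=\frac{e^{i\frac\omega c|x|}}{4\pi|x|}$ and let $\mathbf G=G\,\mathbb 1+\frac{c^2}{\omega^2}\operatorname{grad}\operatorname{div}(G\,\mathbb 1)$, where the integral $\int_\Omega\mathbf G(y-z)g(z)\,dz$ is understood as the matrix with entries $\delta_{ij}w(y)+\frac{c^2}{\omega^2}\partial_i\partial_jw(y)$, $w(y)=\int_\Omega G(y-z)g(z)\,dz$. For $\alpha\in\{z,y\}$ let $$K^{\alpha}(\theta;k)=\frac{\omega^2}{c^2(2\pi)^3}\int_\Omega\int_\Omega\mathbf G(y-z)\,e^{-i\frac\omega c(z_3+\langle\theta,y\rangle)}e^{i\langle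 k,\alpha\rangle}\,dz\,dy ,$$ $\mathcal K[F](\theta)=\int_{\mathbb R^3}K^z(\theta;k)F(k)\,dk$ and $\mathcal K^\dagger[F](\theta)=\int_{\mathbb R^3}F(k)K^y(\theta;k)\,dk$ for matrix-valued $F$; let $\mathcal K_{kj}$, $\mathcal K_{kj}^\dagger$ be the scalar operators with the kernels $K^z_{kj}$, $K^y_{kj}$. *Reduced system.* For $\psi_{11},\psi_{12},\psi_{22},\psi_{33}\in L^2(\Omega)$ and $\theta\in\mathbb S^2$ let $$\tilde\psi=\begin{pmatrix}\tilde\psi_{11}&\tilde\psi_{12}&0\\ \tilde\psi_{12}&\tilde\psi_{22}&0\\0&0&\tilde\psi_{33}\end{pmatrix},\quad \boldsymbol\chi_0=\chi_0\begin{pmatrix}1&1&0\\1&1&0\\0&0&1\end{pmatrix},\quad Y=\tilde\psi(v)+\boldsymbol\chi_0\mathcal K[\tilde\psi](\theta)+\mathcal K^\dagger[\tilde\psi](\theta)\boldsymbol\chi_0 .$$ The incident polarisations $q^{(1)}=e_1$, $q^{(2)}=e_2$ give, after a quarter-wave plate at the angle $\pi/4$, $p^{(1)}=\frac12(1-i,1+i,0)^T$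 and $p^{(2)}=\frac12(1+i,1-i,0)^T$. For arbitrary data $m^{(k)}_j:\mathbb S^2\to\mathbb C$ ($k,j=1,2$) let $b^{(k)}_j=-\sqrt2\,m^{(k)}_j$. The reduced system in the direction $\theta$ is $$[P_\theta Yp^{(1)}]_1=b^{(1)}_1,\quad[P_\theta Yp^{(1)}]_2=b^{(1)}_2,\quad[P_\theta Yp^{(2)}]_1=b^{(2)}_1,\quad[P_\theta Yp^{(2)}]_2=-b^{(2)}_2 .$$ *Fredholm operators.* Write $P=P_\theta$, $\mathbf y=(y_1,y_2,y_3)=(\tilde\psi_{11},\tilde\psi_{12},\tilde\psi_{22})$, and for $k=1,2$, $p\in\mathbb C^3$ let $$\mathcal L_{kj}=(P_{k1}+P_{k2})(\mathcal K_{1j}+\mathcal K_{2j})+P_{k3}\mathcal K_{3j},\qquad \mathcal M_j=\mathcal K^\dagger_{j1}+\mathcal K^\dagger_{j2},$$ $$I_k(p)=\big(P_{k1}p_1,\ P_{k1}p_2+P_{k2}p_1,\ P_{k2}p_2\big),$$ $$L_k(p)\mathbf y=p_1\mathcal L_{k1}y_1+(p_1\mathcal L_{k2}+p_2\mathcal L_{k1})y_2+p_2\mathcal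 L_{k2}y_3,$$ $$M_k\mathbf y=P_{k1}\mathcal M_1y_1+(P_{k2}\mathcal M_1+P_{k1}\mathcal M_2)y_2+P_{k2}\mathcal M_2y_3 .$$ Let $\tilde{\mathcal I}(\theta)$ be the $3\times3$ matrix with rows $I_1(p^{(1)}-p^{(2)})$, $I_2(p^{(1)}-p^{(2)})$, $\theta_2I_1(p^{(1)})-\theta_1I_2(p^{(1)})$; let $$\mathcal N\mathbf y=\chi_0\begin{pmatrix}L_1(p^{(1)}-p^{(2)})\mathbf y\\L_2(p^{(1)}-p^{(2)})\mathbf y\\ \theta_2(L_1(p^{(1)})+M_1)\mathbf y-\theta_1(L_2(p^{(1)})+M_2)\mathbf y\end{pmatrix},\qquad\tilde b=\begin{pmatrix}b^{(1)}_1-b^{(2)}_1\\b^{(1)}_2+b^{(2)}_2\\ \theta_2b^{(1)}_1-\theta_1b^{(1)}_2\end{pmatrix},$$ and put $\mathcal C=\tilde{\mathcal I}^{-1}\mathcal N$, $b=\tilde{\mathcal I}^{-1}\tilde b$, $r_k=b^{(1)}_k-\big(I_k(p^{(1)})\cdot\mathbf y(v)+\chi_0L_k(p^{(1)})\mathbf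 y+\chi_0M_k\mathbf y\big)$ and $$b_{33}=-\frac{\theta_1r_1+\theta_2r_2}{\theta_3(\theta_1^2+\theta_2^2)},$$ which depends only on the data and on $\tilde\psi_{11},\tilde\psi_{12},\tilde\psi_{22}$. *Proposition.* 1. For every $\theta\in\mathbb S^2_*$, $\det\tilde{\mathcal I}(\theta)=(\theta_2-\theta_1)(\theta_1^2+\theta_2^2-1)\neq0$. 2. For all data $m^{(k)}_j$, all $\psi_{11},\psi_{12},\psi_{22},\psi_{33}\in L^2(\Omega)$ and every $\theta\in\mathbb S^2_*$, the reduced system in the direction $\theta$ holds if and only if the equation of the second kind for the first three unknowns and the equation of the first kind for the fourth one hold at $\theta$: $$(\tilde\psi_{11},\tilde\psi_{12},\tilde\psi_{22})^T(v)+\mathcal C[(\tilde\psi_{11},\tilde\psi_{12},\tilde\psi_{22})](\theta)=b(\theta),\qquad \chi_0\,\mathcal M_3[\tilde\psi_{33}](\theta)=b_{33}(\theta).$$ 3. For every measurable $S\subseteq\mathbb S^2_*$ with $\int_S|\det\tilde{\mathcal I}|^{-2}d\sigma<\infty$ (for instance every compact $S\subset\mathbb S^2_*$), the map $(\psi_{11},\psi_{12},\psi_{22})\mapsto\mathcal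 C[(\tilde\psi_{11},\tilde\psi_{12},\tilde\psi_{22})]$ is a compact linear operator $L^2(\Omega)^3\to L^2(S,\sigma)^3$. On the whole of $\mathbb S^2_*$, the map $(\psi_{11},\psi_{12},\psi_{22})\mapsto\det\tilde{\mathcal I}\cdot\mathcal C[(\tilde\psi_{11},\tilde\psi_{12},\tilde\psi_{22})]$ is a compact linear operator $L^2(\Omega)^3\to L^2(\mathbb S^2_*,\sigma)^3$. 4. The map $\psi_{33}\mapsto\mathcal M_3[\tilde\psi_{33}]$ is a compact linear operator $L^2(\Omega)\to L^2(\mathbb S^2,\sigma)$. -/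

import Mathlib

open MeasureTheory
open scoped Matrix ENNReal

noncomputable section

namespace PSOCT

/-- Three-dimensional Euclidean space. -/
abbrev E3 : Type := EuclideanSpace ℝ (Fin 3)

/-- The unit sphere. -/
abbrev S2 : Type := Metric.sphere (0 : E3) 1

/-- The surface measure of the unit sphere. -/
def surfaceMeasure : Measure S2 := (volume : Measure E3).toSphere

/-- The standard basis vectors of space (indexed from 0, so that `basisVec 2` is the
direction of the illumination). -/
def basisVec (i : Fin 3) : E3 := EuclideanSpace.single i 1

/-- The directions with positive third coordinate whose first two coordinates differ. -/
def starDirections : Set S2 := {θ | θ.1 0 ≠ θ.1 1 ∧ 0 < θ.1 2}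

/-- The plane wave `x ↦ exp (i ⟨k, x⟩)`. -/
def planeWave (k x : E3) : ℂ := Complex.exp (Complex.I * ((inner ℝ k x : ℝ) : ℂ))

/-- The Fourier transform `k ↦ ∫_Ω f(x) exp (-i ⟨k, x⟩) dx` of a function on `Ω`
(extended by zero). -/
def fourierOn (Ω : Set E3) (f : E3 → ℂ) (k : E3) : ℂ :=
  ∫ x in Ω, f x * planeWave (-k) x

/-! ### Green's function and Green's tensor -/

/-- The fundamental solution of the scalar Helmholtz equation with wave number `ω / c`. -/
def greenFn (ω c : ℝ) (x : E3) : ℂ :=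
  Complex.exp (Complex.I * ((ω / c * ‖x‖ : ℝ) : ℂ)) / ((4 * Real.pi * ‖x‖ : ℝ) : ℂ)

/-- The volume potential `y ↦ ∫_Ω G(ω, y - z) g(z) dz`. -/
def volumePotential (Ω : Set E3) (ω c : ℝ) (g : E3 → ℂ) (y : E3) : ℂ :=
  ∫ z in Ω, greenFn ω c (y - z) * g z

/-- The partial derivative in the `i`-th coordinate. -/
def partialD (i : Fin 3) (w : E3 → ℂ) (y : E3) : ℂ := fderiv ℝ w y (basisVec i)

/-- The `(i, j)` entry of `∫_Ω 𝐆(ω, y - z) g(z) dz` with Green's tensor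
`𝐆 = G 𝟙 + (c² / ω²) grad div (G 𝟙)`; since `𝐆` is strongly singular, the derivatives act on the
volume potential. It is used for smooth `g`, whose volume potential is smooth inside `Ω`. -/
def tensorPotential (Ω : Set E3) (ω c : ℝ) (i j : Fin 3) (g : E3 → ℂ) (y : E3) : ℂ :=
  (if i = j then volumePotential Ω ω c g y else 0)
    + ((c ^ 2 / ω ^ 2 : ℝ) : ℂ) * partialD i (partialD j (volumePotential Ω ω c g)) y

/-! ### The integral operators -/

/-- The frequency `v = (ω / c) (θ + e₃)` that is observed in the direction `θ`. -/
def obsFreq (ω c : ℝ) (θ : E3) : E3 := (ω / c) • (θ + basisVec 2)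

/-- The kernel
`ω² / (c² (2π)³) ∫_Ω ∫_Ω 𝐆(ω, y - z) exp (-i (ω/c) (z₃ + ⟨θ, y⟩)) exp (i ⟨k, z⟩) dz dy`. -/
def kernelZ (Ω : Set E3) (ω c : ℝ) (θ k : E3) : Matrix (Fin 3) (Fin 3) ℂ := fun i j =>
  ((ω ^ 2 / (c ^ 2 * (2 * Real.pi) ^ 3) : ℝ) : ℂ) *
    ∫ y in Ω, planeWave (-((ω / c) • θ)) y *
      tensorPotential Ω ω c i j
        (fun z => planeWave (-((ω / c) • basisVec 2)) z * planeWave k z) y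

/-- The kernel
`ω² / (c² (2π)³) ∫_Ω ∫_Ω 𝐆(ω, y - z) exp (-i (ω/c) (z₃ + ⟨θ, y⟩)) exp (i ⟨k, y⟩) dz dy`. -/
def kernelY (Ω : Set E3) (ω c : ℝ) (θ k : E3) : Matrix (Fin 3) (Fin 3) ℂ := fun i j =>
  ((ω ^ 2 / (c ^ 2 * (2 * Real.pi) ^ 3) : ℝ) : ℂ) *
    ∫ y in Ω, planeWave (-((ω / c) • θ)) y * planeWave k y *
      tensorPotential Ω ω c i j (planeWave (-((ω / c) • basisVec 2))) y

/-- The operator `𝒦[F](θ) = ∫ K^z(θ; k) F(k) dk` on matrix-valued functions. -/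
def opK (Ω : Set E3) (ω c : ℝ) (F : E3 → Matrix (Fin 3) (Fin 3) ℂ) (θ : E3) :
    Matrix (Fin 3) (Fin 3) ℂ := fun i j => ∫ k, (kernelZ Ω ω c θ k * F k) i j

/-- The operator `𝒦†[F](θ) = ∫ F(k) K^y(θ; k) dk` on matrix-valued functions. -/
def opKdag (Ω : Set E3) (ω c : ℝ) (F : E3 → Matrix (Fin 3) (Fin 3) ℂ) (θ : E3) :
    Matrix (Fin 3) (Fin 3) ℂ := fun i j => ∫ k, (F k * kernelY Ω ω c θ k) i j

/-! ### The reduced measurement system -/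

/-- The matrix with the entries `y 0 = ψ₁₁`, `y 1 = ψ₁₂`, `y 2 = ψ₂₂`, `s = ψ₃₃` of an
orthotropic medium. -/
def orthoMatrix (y : Fin 3 → E3 → ℂ) (s : E3 → ℂ) (k : E3) : Matrix (Fin 3) (Fin 3) ℂ :=
  !![y 0 k, y 1 k, 0; y 1 k, y 2 k, 0; 0, 0, s k]

/-- The background susceptibility. -/
def background (χ₀ : ℝ) : Matrix (Fin 3) (Fin 3) ℂ :=
  (χ₀ : ℂ) • !![1, 1, 0; 1, 1, 0; 0, 0, 1]

/-- The matrix `Y = F(v) + χ₀ 𝒦[F](v) + 𝒦†[F](v) χ₀`, where `F` is the Fourier transform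
of the matrix of unknowns. -/
def matY (Ω : Set E3) (ω c χ₀ : ℝ) (F : E3 → Matrix (Fin 3) (Fin 3) ℂ) (θ : E3) :
    Matrix (Fin 3) (Fin 3) ℂ :=
  F (obsFreq ω c θ) + background χ₀ * opK Ω ω c F θ + opKdag Ω ω c F θ * background χ₀

/-- The orthogonal projection `𝟙 - θ θᵀ`. -/
def proj (θ : E3) : Matrix (Fin 3) (Fin 3) ℂ := fun i j =>
  (if i = j then 1 else 0) - (θ i : ℂ) * (θ j : ℂ)

/-- The Jones matrix of a quarter-wave plate with fast axis at the angle `φ`. -/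
def jones (φ : ℝ) : Matrix (Fin 3) (Fin 3) ℂ :=
  !![(Real.cos φ : ℂ), -(Real.sin φ : ℂ), 0; (Real.sin φ : ℂ), (Real.cos φ : ℂ), 0; 0, 0, 1]
    * !![1, 0, 0; 0, -Complex.I, 0; 0, 0, 1]
    * !![(Real.cos φ : ℂ), (Real.sin φ : ℂ), 0; -(Real.sin φ : ℂ), (Real.cos φ : ℂ), 0; 0, 0, 1]

/-- The polarisation `p` of the light that reaches the medium when the incident polarisation
is `q`. -/
def samplePol (q : Fin 3 → ℂ) : Fin 3 → ℂ := jones (Real.pi / 4) *ᵥ q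

/-- The vector `p⁽¹⁾`, for the incident polarisation `q⁽¹⁾ = e₁`. -/
def pol1 : Fin 3 → ℂ := samplePol ![1, 0, 0]

/-- The vector `p⁽²⁾`, for the incident polarisation `q⁽²⁾ = e₂`. -/
def pol2 : Fin 3 → ℂ := samplePol ![0, 1, 0]

/-- The right hand sides `b⁽ᵏ⁾_j = -√2 m⁽ᵏ⁾_j` for the measurement data `m`
(first index `k`, second index `j`). -/
def dataB (m : Fin 2 → Fin 2 → S2 → ℂ) (k j : Fin 2) (θ : S2) : ℂ :=
  -(Real.sqrt 2 : ℂ) * m k j θ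

/-- The reduced system of the four measurement equations in the direction `θ`. -/
def ReducedSystem (Ω : Set E3) (ω c χ₀ : ℝ) (m : Fin 2 → Fin 2 → S2 → ℂ)
    (y : Fin 3 → E3 → ℂ) (s : E3 → ℂ) (θ : S2) : Prop :=
  (proj θ *ᵥ (matY Ω ω c χ₀ (orthoMatrix y s) θ *ᵥ pol1)) 0 = dataB m 0 0 θ ∧
  (proj θ *ᵥ (matY Ω ω c χ₀ (orthoMatrix y s) θ *ᵥ pol1)) 1 = dataB m 0 1 θ ∧
  (proj θ *ᵥ (matY Ω ω c χ₀ (orthoMatrix y s) θ *ᵥ pol2)) 0 = dataB m 1 0 θ ∧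
  (proj θ *ᵥ (matY Ω ω c χ₀ (orthoMatrix y s) θ *ᵥ pol2)) 1 = -dataB m 1 1 θ

/-! ### The Fredholm equations -/

/-- The scalar operator `𝒦_{kj}[f](θ) = ∫ [K^z]_{kj}(θ; κ) f(κ) dκ`. -/
def scalK (Ω : Set E3) (ω c : ℝ) (k j : Fin 3) (f : E3 → ℂ) (θ : E3) : ℂ :=
  ∫ κ, kernelZ Ω ω c θ κ k j * f κ

/-- The scalar operator `𝒦†_{kj}[f](θ) = ∫ [K^y]_{kj}(θ; κ) f(κ) dκ`. -/
def scalKdag (Ω : Set E3) (ω c : ℝ) (k j : Fin 3) (f : E3 → ℂ) (θ : E3) : ℂ :=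
  ∫ κ, kernelY Ω ω c θ κ k j * f κ

/-- The operators `ℒ_{kj}`, the entries of `(𝟙 - θ θᵀ) χ₀ 𝒦` without the factor `χ₀`. -/
def opL (Ω : Set E3) (ω c : ℝ) (k j : Fin 3) (f : E3 → ℂ) (θ : E3) : ℂ :=
  (proj θ k 0 + proj θ k 1) * (scalK Ω ω c 0 j f θ + scalK Ω ω c 1 j f θ)
    + proj θ k 2 * scalK Ω ω c 2 j f θ

/-- The operators `ℳ_j = 𝒦†_{j1} + 𝒦†_{j2}`. -/
def opM (Ω : Set E3) (ω c : ℝ) (j : Fin 3) (f : E3 → ℂ) (θ : E3) : ℂ :=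
  scalKdag Ω ω c j 0 f θ + scalKdag Ω ω c j 1 f θ

/-- The `k`-th row of the matrix `ℐ(p)` (its fourth entry is zero). -/
def rowI (p : Fin 3 → ℂ) (θ : E3) (k : Fin 3) : Fin 3 → ℂ :=
  ![proj θ k 0 * p 0, proj θ k 0 * p 1 + proj θ k 1 * p 0, proj θ k 1 * p 1]

/-- The `k`-th row of `ℒ(p)`, applied to `(ψ₁₁, ψ₁₂, ψ₂₂)` (its fourth entry is zero). -/
def rowL (Ω : Set E3) (ω c : ℝ) (p : Fin 3 → ℂ) (y : Fin 3 → E3 → ℂ) (θ : E3) (k : Fin 3) : ℂ :=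
  p 0 * opL Ω ω c k 0 (y 0) θ
    + (p 0 * opL Ω ω c k 1 (y 1) θ + p 1 * opL Ω ω c k 0 (y 1) θ)
    + p 1 * opL Ω ω c k 1 (y 2) θ

/-- The first three entries of the `k`-th row of `ℳ`, applied to `(ψ₁₁, ψ₁₂, ψ₂₂)`. -/
def rowM (Ω : Set E3) (ω c : ℝ) (y : Fin 3 → E3 → ℂ) (θ : E3) (k : Fin 3) : ℂ :=
  proj θ k 0 * opM Ω ω c 0 (y 0) θ
    + (proj θ k 1 * opM Ω ω c 0 (y 1) θ + proj θ k 0 * opM Ω ω c 1 (y 1) θ)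
    + proj θ k 1 * opM Ω ω c 1 (y 2) θ

/-- The matrix `Ĩ`, the multiplication part of the three equations without `ψ₃₃`: the differences
of the first and third and of the second and fourth equation of the reduced system, and `θ₂` times
the first minus `θ₁` times the second. -/
def matI (θ : E3) : Matrix (Fin 3) (Fin 3) ℂ :=
  ![rowI (pol1 - pol2) θ 0,
    rowI (pol1 - pol2) θ 1,
    (θ 1 : ℂ) • rowI pol1 θ 0 - (θ 0 : ℂ) • rowI pol1 θ 1]

/-- The operator `𝒩`, the integral part of the same three equations. -/
def opN (Ω : Set E3) (ω c χ₀ : ℝ) (y : Fin 3 → E3 → ℂ) (θ : E3) : Fin 3 → ℂ :=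
  (χ₀ : ℂ) • ![rowL Ω ω c (pol1 - pol2) y θ 0,
    rowL Ω ω c (pol1 - pol2) y θ 1,
    (θ 1 : ℂ) * (rowL Ω ω c pol1 y θ 0 + rowM Ω ω c y θ 0)
      - (θ 0 : ℂ) * (rowL Ω ω c pol1 y θ 1 + rowM Ω ω c y θ 1)]

/-- The right hand sides of the same three equations. -/
def dataTilde (m : Fin 2 → Fin 2 → S2 → ℂ) (θ : S2) : Fin 3 → ℂ :=
  ![dataB m 0 0 θ - dataB m 1 0 θ,
    dataB m 0 1 θ + dataB m 1 1 θ,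
    (θ.1 1 : ℂ) * dataB m 0 0 θ - (θ.1 0 : ℂ) * dataB m 0 1 θ]

/-- The operator `𝒞 = Ĩ⁻¹ 𝒩` of the equation of the second kind. -/
def opC (Ω : Set E3) (ω c χ₀ : ℝ) (y : Fin 3 → E3 → ℂ) (θ : E3) : Fin 3 → ℂ :=
  (matI θ)⁻¹ *ᵥ opN Ω ω c χ₀ y θ

/-- The right hand side of the equation of the second kind. -/
def rhsSecond (m : Fin 2 → Fin 2 → S2 → ℂ) (θ : S2) : Fin 3 → ℂ :=
  (matI θ)⁻¹ *ᵥ dataTilde m θ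

/-- The part of the `k`-th equation for `p⁽¹⁾` that is known from the data and from
`(ψ₁₁, ψ₁₂, ψ₂₂)`. -/
def knownResidual (Ω : Set E3) (ω c χ₀ : ℝ) (m : Fin 2 → Fin 2 → S2 → ℂ)
    (y : Fin 3 → E3 → ℂ) (θ : S2) (k : Fin 2) : ℂ :=
  dataB m 0 k θ
    - (rowI pol1 θ k.castSucc ⬝ᵥ (fun i => y i (obsFreq ω c θ))
      + (χ₀ : ℂ) * rowL Ω ω c pol1 y θ k.castSucc
      + (χ₀ : ℂ) * rowM Ω ω c y θ k.castSucc)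

/-- The right hand side of the equation of the first kind, which depends on the data and on
`(ψ₁₁, ψ₁₂, ψ₂₂)` only. -/
def rhsFirst (Ω : Set E3) (ω c χ₀ : ℝ) (m : Fin 2 → Fin 2 → S2 → ℂ)
    (y : Fin 3 → E3 → ℂ) (θ : S2) : ℂ :=
  -((θ.1 0 : ℂ) * knownResidual Ω ω c χ₀ m y θ 0 + (θ.1 1 : ℂ) * knownResidual Ω ω c χ₀ m y θ 1)
    / ((θ.1 2 : ℂ) * ((θ.1 0 : ℂ) ^ 2 + (θ.1 1 : ℂ) ^ 2))

end PSOCT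

end

open PSOCT

/-! Compactness rests on one observation: for `ψ ∈ L²(Ω)` each scalar operator, applied to the
Fourier transform of `ψ` and evaluated at `θ`, is a constant times `∫_Ω h_θ ψ`, where `h_θ ∈ L²(Ω)`
depends continuously on `θ` in the norm of `L²` (`scalK_eq`, `scalKdag_eq`,
`continuous_kernelDensity`). A norm continuous family of functionals on the compact sphere maps the
unit ball to an equicontinuous bounded set, so by Arzelà–Ascoli it is a compact operator into
`C(S²)`; multiplication by a square integrable function then leads into `L²`
(`exists_isCompactOperator_of_family`). For `𝒞` this function is `1 / det Ĩ`, and the adjugate of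
`Ĩ` is absorbed into the continuous family.

The densities `h_θ` contain the Green tensor applied to a plane wave on `Ω`. The tensor is strongly
singular, so its boundedness on `L²` has to be proved. As `Ω` is bounded, `G` may be cut off
smoothly outside the set of differences of points of `Ω`. The Fourier transform of the cut-off
kernel is `O(|ξ|⁻²)` (`exists_sq_norm_mul_fourier_regGreen_le`), hence the symbol with the extra
factor `ξᵢ ξⱼ` is bounded and defines an `L²` multiplier `greenOp`. Testing against smooth functions
supported in `Ω` identifies it with the classical derivatives of the volume potential
(`tensorPotential_ae_eq_greenOp`). The symbol is even, so the multiplier is symmetric for the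
bilinear pairing; this moves the factor `exp (i ⟨k, z⟩)` of `K^z` out of the tensor. Both kernels
are then Fourier integrals over `Ω` in `k`, and Parseval's formula evaluates the integral over `k`.

The equivalence is linear algebra. Both polarisations satisfy `p₁ + p₂ = 1` and `p₃ = 0`, so `ψ₃₃`
enters the two observed components only through `χ₀ ℳ₃`, with the factors `-θ₁θ₃` and `-θ₂θ₃`, equal
for both polarisations. The differences of equations and the combination `θ₂ · (first) - θ₁ ·
(second)` eliminate it; `θ₁ · (first) + θ₂ · (second)` determines it (`reduced_equations_iff`). -/

open PSOCT

/-! ### Compact operators from norm continuous families of functionals. -/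

section Compactness

variable {K H : Type*} [TopologicalSpace K] [CompactSpace K]
  [NormedAddCommGroup H] [NormedSpace ℂ H]

/-- The operator that evaluates a continuous family of functionals. -/
noncomputable def evalFamily (A : C(K, H →L[ℂ] ℂ)) : H →L[ℂ] C(K, ℂ) :=
  LinearMap.mkContinuous
    { toFun := fun ψ => ⟨fun θ => A θ ψ, by fun_prop⟩
      map_add' := fun x y => by ext; simp
      map_smul' := fun a x => by ext; simp }
    ‖A‖ (fun ψ => by
      refine (ContinuousMap.norm_le _ (by positivity)).2 fun θ => ?_
      exact ((A θ).le_opNorm ψ).trans (by gcongr; exact A.norm_coe_le_norm θ))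

theorem isCompactOperator_evalFamily (A : C(K, H →L[ℂ] ℂ)) :
    IsCompactOperator (evalFamily A) := by
  refine (isCompactOperator_iff_isCompact_closure_image_closedBall (evalFamily A).toLinearMap
    one_pos).2 ?_
  let B : Set (BoundedContinuousFunction K ℂ) :=
    (ContinuousMap.equivBoundedOfCompact K ℂ) '' (evalFamily A '' Metric.closedBall 0 1)
  have hB : IsCompact (closure B) := by
    -- The images of the unit ball take values in the ball of radius `‖A‖`, and norm continuity of
    -- `A` gives one modulus of continuity for all of them.
    refine BoundedContinuousFunction.arzela_ascoli (Metric.closedBall 0 ‖A‖)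
      (isCompact_closedBall _ _) B ?_ ?_
    · rintro _ θ ⟨_, ⟨ψ, hψ, rfl⟩, rfl⟩
      rw [mem_closedBall_zero_iff] at hψ ⊢
      refine ((A θ).le_opNorm ψ).trans ?_
      have := A.norm_coe_le_norm θ
      nlinarith [norm_nonneg (A θ), norm_nonneg ψ]
    · intro θ₀
      rw [Metric.equicontinuousAt_iff_right]
      intro ε hε
      have := (A.continuous.continuousAt (x := θ₀)).eventually (Metric.ball_mem_nhds _ hε)
      filter_upwards [this] with θ hθ
      rintro ⟨_, _, ⟨ψ, hψ, rfl⟩, rfl⟩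
      rw [mem_closedBall_zero_iff] at hψ
      rw [dist_eq_norm]
      change ‖A θ₀ ψ - A θ ψ‖ < ε
      rw [← sub_apply]
      refine ((A θ₀ - A θ).le_opNorm ψ).trans_lt ?_
      rw [dist_comm, dist_eq_norm] at hθ
      nlinarith [norm_nonneg (A θ₀ - A θ), norm_nonneg ψ]
  have h2 : IsCompact ((ContinuousMap.isometryEquivBoundedOfCompact K ℂ).symm '' closure B) :=
    hB.image (ContinuousMap.isometryEquivBoundedOfCompact K ℂ).symm.continuous
  refine h2.of_isClosed_subset isClosed_closure (closure_minimal ?_ h2.isClosed)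
  rintro _ ⟨ψ, hψ, rfl⟩
  exact ⟨_, subset_closure ⟨_, ⟨ψ, hψ, rfl⟩, rfl⟩, rfl⟩

variable [MeasurableSpace K] [BorelSpace K] (μ : Measure K) [IsFiniteMeasure μ]

theorem memLp_mul_continuousMap {a : K → ℂ} (ha : MemLp a 2 μ) (f : C(K, ℂ)) :
    MemLp (fun θ => a θ * f θ) 2 μ :=
  (MemLp.of_bound (p := ∞) f.continuous.aestronglyMeasurable ‖f‖
    (Filter.Eventually.of_forall f.norm_coe_le_norm)).mul (r := 2) ha

/-- Multiplication of continuous functions by a square integrable function. -/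
noncomputable def mulContinuousMap {a : K → ℂ} (ha : MemLp a 2 μ) : C(K, ℂ) →L[ℂ] Lp ℂ 2 μ :=
  LinearMap.mkContinuous
    { toFun := fun f => (memLp_mul_continuousMap μ ha f).toLp
      map_add' := fun f g => by
        rw [← MemLp.toLp_add]
        exact MemLp.toLp_congr _ _ (Filter.Eventually.of_forall fun θ => by simp [mul_add])
      map_smul' := fun z f => by
        rw [RingHom.id_apply, ← MemLp.toLp_const_smul]
        exact MemLp.toLp_congr _ _ (Filter.Eventually.of_forall fun θ => by
          simp; ring) }
    ‖ha.toLp‖ (fun f => by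
      refine (Lp.norm_le_mul_norm_of_ae_le_mul (c := ‖f‖) (g := ha.toLp) ?_).trans_eq
        (mul_comm _ _)
      filter_upwards [(memLp_mul_continuousMap μ ha f).coeFn_toLp, ha.coeFn_toLp] with θ h1 h2
      change ‖(memLp_mul_continuousMap μ ha f).toLp _ θ‖ ≤ _
      rw [h1, h2, norm_mul, mul_comm]
      gcongr
      exact f.norm_coe_le_norm θ)

theorem mulContinuousMap_coeFn {a : K → ℂ} (ha : MemLp a 2 μ) (f : C(K, ℂ)) :
    mulContinuousMap μ ha f =ᵐ[μ] fun θ => a θ * f θ :=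
  (memLp_mul_continuousMap μ ha f).coeFn_toLp

/-- A continuous family of functionals on a compact space, multiplied by a square integrable
function, defines a compact operator into `L²`. -/
theorem exists_isCompactOperator_of_family {a : K → ℂ} (ha : MemLp a 2 μ)
    (A : C(K, H →L[ℂ] ℂ)) :
    ∃ T : H →L[ℂ] Lp ℂ 2 μ, IsCompactOperator T ∧
      ∀ ψ, T ψ =ᵐ[μ] fun θ => a θ * A θ ψ :=
  ⟨(mulContinuousMap μ ha).comp (evalFamily A),
    (isCompactOperator_evalFamily A).clm_comp (mulContinuousMap μ ha),
    fun ψ => mulContinuousMap_coeFn μ ha (evalFamily A ψ)⟩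

/-- A product of compact sets is compact, and its preimage is a finite intersection of
neighbourhoods of `0`. -/
theorem IsCompactOperator.pi {ι : Type*} [Finite ι] {E F : Type*}
    [NormedAddCommGroup E] [NormedSpace ℂ E]
    [NormedAddCommGroup F] [NormedSpace ℂ F]
    {T : ι → E →L[ℂ] F} (hT : ∀ i, IsCompactOperator (T i)) :
    IsCompactOperator (ContinuousLinearMap.pi T) := by
  choose C hC hCT using hT
  exact ⟨Set.univ.pi C, isCompact_univ_pi hC,
    by
      have : (ContinuousLinearMap.pi T) ⁻¹' (Set.univ.pi C) = ⋂ i, T i ⁻¹' C i := by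
        ext x; simp
      rw [this]
      exact Filter.iInter_mem.2 hCT⟩

theorem exists_isCompactOperator_of_families {ι : Type*} [Finite ι] {a : K → ℂ}
    (ha : MemLp a 2 μ) (A : ι → C(K, H →L[ℂ] ℂ)) :
    ∃ T : H →L[ℂ] (ι → Lp ℂ 2 μ), IsCompactOperator T ∧
      ∀ ψ i, T ψ i =ᵐ[μ] fun θ => a θ * A i θ ψ := by
  choose T hT hTA using fun i => exists_isCompactOperator_of_family μ ha (A i)
  exact ⟨ContinuousLinearMap.pi T, IsCompactOperator.pi hT, fun ψ i => hTA i ψ⟩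

end Compactness

/-! ### The `L²` Fourier transform as an integral, and Parseval's formula. -/

section FourierL2
open scoped FourierTransform SchwartzMap ContDiff

variable {E : Type*} [NormedAddCommGroup E] [InnerProductSpace ℝ E] [FiniteDimensional ℝ E]
  [MeasurableSpace E] [BorelSpace E]

theorem integral_fourier_mul_eq_flip {f g : E → ℂ} (hf : Integrable f) (hg : Integrable g) :
    ∫ ξ, 𝓕 f ξ * g ξ = ∫ x, f x * 𝓕 g x := by
  have := VectorFourier.integral_fourierIntegral_smul_eq_flip (μ := (volume : Measure E))
    (ν := (volume : Measure E)) (L := innerₗ E) (f := f) (g := g)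
    Real.continuous_fourierChar continuous_inner hf hg
  simpa only [flip_innerₗ, smul_eq_mul] using! this

theorem continuous_fourier {f : E → ℂ} (hf : Integrable f) : Continuous (𝓕 f) :=
  VectorFourier.fourierIntegral_continuous Real.continuous_fourierChar
    (by exact continuous_inner) hf

/-- The `L²` transform is compatible with the transform of tempered distributions, and the latter is
defined by moving it to the test function. -/
theorem integral_fourier_toLp_mul {f : E → ℂ} (h2 : MemLp f 2) (φ : 𝓢(E, ℂ)) :
    ∫ x, φ x * (𝓕 (h2.toLp f) : Lp ℂ 2 (volume : Measure E)) x = ∫ x, 𝓕 φ x * f x := by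
  have h := congrArg (fun T : 𝓢'(E, ℂ) => T φ) (Lp.fourier_toTemperedDistribution_eq (h2.toLp f))
  simp only [TemperedDistribution.fourier_apply, Lp.toTemperedDistribution_apply, smul_eq_mul] at h
  rw [← h]
  refine integral_congr_ae ?_
  filter_upwards [h2.coeFn_toLp] with x hx
  rw [hx]

theorem integral_fourierInv_toLp_mul {f : E → ℂ} (h2 : MemLp f 2) (φ : 𝓢(E, ℂ)) :
    ∫ x, φ x * (𝓕⁻ (h2.toLp f) : Lp ℂ 2 (volume : Measure E)) x = ∫ x, 𝓕⁻ φ x * f x := by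
  have h := congrArg (fun T : 𝓢'(E, ℂ) => T φ)
    (Lp.fourierInv_toTemperedDistribution_eq (h2.toLp f))
  simp only [TemperedDistribution.fourierInv_apply, Lp.toTemperedDistribution_apply,
    smul_eq_mul] at h
  rw [← h]
  refine integral_congr_ae ?_
  filter_upwards [h2.coeFn_toLp] with x hx
  rw [hx]

/-- For functions in `L¹ ∩ L²` the Fourier transform of `L²` is the Fourier integral. -/
theorem fourier_toLp_ae_eq {f : E → ℂ} (h1 : Integrable f) (h2 : MemLp f 2) :
    -- Both sides are locally integrable and have the same integral against every smooth compactly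
    -- supported function.
    (𝓕 (h2.toLp f) : Lp ℂ 2 (volume : Measure E)) =ᵐ[volume] 𝓕 f := by
  refine ae_eq_of_integral_contDiff_smul_eq
    ((Lp.memLp _).locallyIntegrable (by norm_num))
    (continuous_fourier h1).locallyIntegrable fun g hg hgc => ?_
  have hgc' : HasCompactSupport (fun x => (g x : ℂ)) :=
    hgc.comp_left (g := ((↑) : ℝ → ℂ)) Complex.ofReal_zero
  let φ : 𝓢(E, ℂ) := hgc'.toSchwartzMap (Complex.ofRealCLM.contDiff.comp hg)
  have hφ : ∀ x, φ x = (g x : ℂ) := fun x => rfl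
  have h := integral_fourier_toLp_mul h2 φ
  simp only [Complex.real_smul, ← hφ]
  rw [h, integral_congr_ae (Filter.Eventually.of_forall fun x => mul_comm (φ x) (𝓕 f x)),
    integral_fourier_mul_eq_flip h1 φ.integrable]
  refine integral_congr_ae (Filter.Eventually.of_forall fun x => ?_)
  simp only [SchwartzMap.fourier_coe, mul_comm]

theorem memLp_fourier {f : E → ℂ} (h1 : Integrable f) (h2 : MemLp f 2) : MemLp (𝓕 f) 2 :=
  (memLp_congr_ae (fourier_toLp_ae_eq h1 h2)).1 (Lp.memLp _)

/-- The bilinear pairing of two square integrable functions. -/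
noncomputable def pairL2 {α : Type*} [MeasurableSpace α] (μ : Measure α) :
    Lp ℂ 2 μ →L[ℂ] Lp ℂ 2 μ →L[ℂ] ℂ :=
  ContinuousLinearMap.lpPairing μ 2 2 (ContinuousLinearMap.mul ℂ ℂ)

theorem pairL2_apply {α : Type*} [MeasurableSpace α] (μ : Measure α) (f g : Lp ℂ 2 μ) :
    pairL2 μ f g = ∫ x, f x * g x ∂μ := by
  simp [pairL2, ContinuousLinearMap.lpPairing_eq_integral]

/-- Both sides are continuous in `a`, so it suffices to take `a` in the dense image of the Schwartz
space, where duality of tempered distributions applies. The pairing has no complex conjugation,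
hence the same `𝓕⁻` on both sides. -/
theorem pairL2_fourierInv (a b : Lp ℂ 2 (volume : Measure E)) :
    pairL2 volume a (𝓕⁻ b) = pairL2 volume (𝓕⁻ a) b := by
  refine DenseRange.induction_on
    (p := fun a => pairL2 volume a (𝓕⁻ b) = pairL2 volume (𝓕⁻ a) b)
    (SchwartzMap.denseRange_toLpCLM (E := E) (F := ℂ) (μ := volume) (p := 2)
      ENNReal.ofNat_ne_top) a ?_ fun φ => ?_
  · refine isClosed_eq ?_ ?_
    · exact ((pairL2 volume).flip (𝓕⁻ b)).continuous
    · exact ((pairL2 volume).flip b).continuous.comp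
        (ContinuousFourierInv.continuous_fourierInv (E := Lp ℂ 2 (volume : Measure E)))
  · have h := congrArg (fun T : 𝓢'(E, ℂ) => T φ) (Lp.fourierInv_toTemperedDistribution_eq b)
    simp only [TemperedDistribution.fourierInv_apply, Lp.toTemperedDistribution_apply,
      smul_eq_mul] at h
    simp only [SchwartzMap.toLpCLM_apply, SchwartzMap.toLp_fourierInv_eq, pairL2_apply]
    calc _ = ∫ x, φ x * (𝓕⁻ b : Lp ℂ 2 (volume : Measure E)) x := by
          refine integral_congr_ae ?_
          filter_upwards [φ.coeFn_toLp 2] with x hx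
          rw [hx]
      _ = _ := by
          rw [← h]
          refine integral_congr_ae ?_
          filter_upwards [(𝓕⁻ φ).coeFn_toLp 2] with x hx
          rw [hx]

theorem fourierInv_toLp_ae_eq {f : E → ℂ} (h1 : Integrable f) (h2 : MemLp f 2) :
    (𝓕⁻ (h2.toLp f) : Lp ℂ 2 (volume : Measure E)) =ᵐ[volume] fun ξ => 𝓕 f (-ξ) := by
  have hneg : (fun ξ => 𝓕 f (-ξ)) = 𝓕 (fun x => f (-x)) := by
    ext ξ
    simpa [Function.comp_def] using
      (Real.fourier_comp_linearIsometry (LinearIsometryEquiv.neg ℝ (E := E)) f ξ).symm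
  rw [hneg]
  refine ae_eq_of_integral_contDiff_smul_eq
    ((Lp.memLp _).locallyIntegrable (by norm_num))
    (continuous_fourier h1.comp_neg).locallyIntegrable fun g hg hgc => ?_
  have hgc' : HasCompactSupport (fun x => (g x : ℂ)) :=
    hgc.comp_left (g := ((↑) : ℝ → ℂ)) Complex.ofReal_zero
  let φ : 𝓢(E, ℂ) := hgc'.toSchwartzMap (Complex.ofRealCLM.contDiff.comp hg)
  have hφ : ∀ x, φ x = (g x : ℂ) := fun x => rfl
  simp only [Complex.real_smul, ← hφ]
  rw [integral_fourierInv_toLp_mul h2 φ,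
    integral_congr_ae (Filter.Eventually.of_forall fun x => mul_comm (φ x) _),
    integral_fourier_mul_eq_flip h1.comp_neg φ.integrable, ← integral_neg_eq_self]
  refine integral_congr_ae (Filter.Eventually.of_forall fun x => ?_)
  simp only [SchwartzMap.fourierInv_coe, Real.fourierInv_eq_fourier_neg, neg_neg, mul_comm]

/-- Parseval's formula, in bilinear form. -/
theorem integral_fourier_neg_mul_fourier {a b : E → ℂ} (ha1 : Integrable a) (ha2 : MemLp a 2)
    (hb1 : Integrable b) (hb2 : MemLp b 2) :
    ∫ ξ, 𝓕 a (-ξ) * 𝓕 b ξ = ∫ x, a x * b x := by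
  have h := pairL2_fourierInv (ha2.toLp a) (𝓕 (hb2.toLp b))
  rw [FourierTransform.fourierInv_fourier_eq, pairL2_apply, pairL2_apply] at h
  calc _ = _ := integral_congr_ae ?_
    _ = _ := h.symm
    _ = _ := integral_congr_ae ?_
  · filter_upwards [fourierInv_toLp_ae_eq ha1 ha2, fourier_toLp_ae_eq hb1 hb2] with x h1 h2
    rw [h1, h2]
  · filter_upwards [ha2.coeFn_toLp, hb2.coeFn_toLp] with x h1 h2
    rw [h1, h2]

end FourierL2

/-! ### The Helmholtz kernel as a function of the squared radius. -/

section RadialProfile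

/-- The function `p ↦ exp (i κ √p) / (√p)ⁿ`. -/
noncomputable def radialWave (κ : ℝ) (n : ℕ) (p : ℝ) : ℂ :=
  Complex.exp (Complex.I * (κ * √p : ℝ)) * (((√p : ℝ) : ℂ) ^ n)⁻¹

theorem norm_radialWave (κ : ℝ) (n : ℕ) (p : ℝ) : ‖radialWave κ n p‖ = (√p ^ n)⁻¹ := by
  rw [radialWave, norm_mul, mul_comm Complex.I, Complex.norm_exp_ofReal_mul_I, one_mul, norm_inv,
    norm_pow, Complex.norm_real, Real.norm_of_nonneg (Real.sqrt_nonneg p)]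

/-- Differentiation in `p` stays within the family and only raises `n`, so every derivative needed
later has an explicit modulus by `norm_radialWave`. -/
theorem hasDerivAt_radialWave (κ : ℝ) (n : ℕ) {p : ℝ} (hp : 0 < p) :
    HasDerivAt (radialWave κ n)
      (Complex.I * κ / 2 * radialWave κ (n + 1) p - n / 2 * radialWave κ (n + 2) p) p := by
  have hs : (√p) ≠ 0 := (Real.sqrt_pos.2 hp).ne'
  have hs' : ((√p : ℝ) : ℂ) ≠ 0 := by exact_mod_cast hs
  have h1 : HasDerivAt (fun p : ℝ => ((√p : ℝ) : ℂ)) ((1 / (2 * √p) : ℝ) : ℂ) p :=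
    (Real.hasDerivAt_sqrt hp.ne').ofReal_comp
  have h2 : HasDerivAt (fun p : ℝ => Complex.exp (Complex.I * (κ * √p : ℝ)))
      (Complex.exp (Complex.I * (κ * √p : ℝ)) * (Complex.I * (κ * (1 / (2 * √p) : ℝ)))) p := by
    have := ((h1.const_mul (κ : ℂ)).const_mul Complex.I).cexp
    simpa only [Complex.ofReal_mul] using this
  have h3 := h2.mul ((h1.pow n).inv (pow_ne_zero n hs'))
  refine h3.congr_deriv ?_
  simp only [radialWave, Pi.pow_apply]
  push_cast
  rcases n with _ | n
  · simp; field_simp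
  · push_cast
    field_simp
    simp [pow_succ]
    field_simp
    ring

theorem hasDerivAt_radialWave_one (κ : ℝ) {p : ℝ} (hp : 0 < p) :
    HasDerivAt (radialWave κ 1)
      (Complex.I * κ / 2 * radialWave κ 2 p - 1 / 2 * radialWave κ 3 p) p := by
  simpa using hasDerivAt_radialWave κ 1 hp

theorem hasDerivAt_radialWave_one_deriv (κ : ℝ) {p : ℝ} (hp : 0 < p) :
    HasDerivAt (fun p => Complex.I * κ / 2 * radialWave κ 2 p - 1 / 2 * radialWave κ 3 p)
      (-(κ ^ 2 / 4) * radialWave κ 3 p - 3 * Complex.I * κ / 4 * radialWave κ 4 p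
        + 3 / 4 * radialWave κ 5 p) p := by
  refine (((hasDerivAt_radialWave κ 2 hp).const_mul _).sub
    ((hasDerivAt_radialWave κ 3 hp).const_mul _)).congr_deriv ?_
  push_cast
  linear_combination (κ ^ 2 / 4 * radialWave κ 3 p) * Complex.I_sq

theorem radialWave_add (κ : ℝ) (n m : ℕ) {p : ℝ} (hp : 0 < p) :
    ((√p : ℝ) : ℂ) ^ m * radialWave κ (n + m) p = radialWave κ n p := by
  have hs' : ((√p : ℝ) : ℂ) ≠ 0 := by exact_mod_cast (Real.sqrt_pos.2 hp).ne'
  simp only [radialWave]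
  field_simp
  rw [pow_add, mul_comm]

/-- In dimension three the Laplacian of `f (|x|²)` is `6 f' + 4 |x|² f''`, and `exp (i κ r) / r`
solves the Helmholtz equation away from the origin. -/
theorem radialWave_helmholtz (κ : ℝ) {p : ℝ} (hp : 0 < p) :
    6 * (Complex.I * κ / 2 * radialWave κ 2 p - 1 / 2 * radialWave κ 3 p)
      + 4 * (p : ℂ) * (-(κ ^ 2 / 4) * radialWave κ 3 p - 3 * Complex.I * κ / 4 * radialWave κ 4 p
        + 3 / 4 * radialWave κ 5 p) = -κ ^ 2 * radialWave κ 1 p := by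
  have hsq : ((√p : ℝ) : ℂ) ^ 2 = p := by exact_mod_cast Real.sq_sqrt hp.le
  have h1 := radialWave_add κ 1 2 hp
  have h2 := radialWave_add κ 2 2 hp
  have h3 := radialWave_add κ 3 2 hp
  rw [hsq] at h1 h2 h3
  linear_combination (-κ ^ 2) * h1 - 3 * Complex.I * κ * h2 + 3 * h3

end RadialProfile

/-! ### Second derivatives of radial functions. -/

section RadialLaplacian

variable {E : Type*} [NormedAddCommGroup E] [InnerProductSpace ℝ E]

theorem hasFDerivAt_comp_norm_sq {f : ℝ → ℂ} {f1 : ℂ} {x : E}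
    (h : HasDerivAt f f1 (‖x‖ ^ 2)) :
    HasFDerivAt (fun x : E => f (‖x‖ ^ 2))
      ((2 * f1) • (Complex.ofRealCLM.comp (innerSL ℝ x))) x := by
  have h2 := h.hasFDerivAt.comp x (hasStrictFDerivAt_norm_sq x).hasFDerivAt
  refine h2.congr_fderiv ?_
  ext v
  simp
  ring

theorem fderiv_comp_norm_sq {f f1 : ℝ → ℂ} (h : ∀ q, 0 ≤ q → HasDerivAt f (f1 q) q) (x v : E) :
    fderiv ℝ (fun x : E => f (‖x‖ ^ 2)) x v = 2 * f1 (‖x‖ ^ 2) * (inner ℝ x v : ℝ) := by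
  rw [(hasFDerivAt_comp_norm_sq (h _ (sq_nonneg ‖x‖))).fderiv]
  simp

theorem fderiv_fderiv_comp_norm_sq {f f1 f2 : ℝ → ℂ} (h : ∀ q, 0 ≤ q → HasDerivAt f (f1 q) q)
    (h1 : ∀ q, 0 ≤ q → HasDerivAt f1 (f2 q) q) (x v : E) :
    fderiv ℝ (fun x => fderiv ℝ (fun x : E => f (‖x‖ ^ 2)) x v) x v =
      2 * f1 (‖x‖ ^ 2) * ((‖v‖ ^ 2 : ℝ) : ℂ)
        + 4 * f2 (‖x‖ ^ 2) * ((inner ℝ x v : ℝ) : ℂ) ^ 2 := by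
  simp_rw [fderiv_comp_norm_sq h]
  have hi : HasFDerivAt (fun x : E => ((inner ℝ x v : ℝ) : ℂ))
      (Complex.ofRealCLM.comp (innerSL ℝ v)) x := by
    have := (Complex.ofRealCLM.comp (innerSL ℝ v)).hasFDerivAt (x := x)
    simpa [Function.comp_def, real_inner_comm v] using! this
  have := ((hasFDerivAt_comp_norm_sq (h1 _ (sq_nonneg ‖x‖))).const_mul 2).mul hi
  rw [show (fun x => 2 * f1 (‖x‖ ^ 2) * ((inner ℝ x v : ℝ) : ℂ)) =
    (fun y => 2 * f1 (‖y‖ ^ 2)) * fun x => ((inner ℝ x v : ℝ) : ℂ) from rfl, this.fderiv]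
  simp
  ring

end RadialLaplacian

/-! ### Fourier transform of second derivatives. -/

section FourierLaplacian
open scoped FourierTransform SchwartzMap ContDiff LineDeriv

theorem SchwartzMap.fourier_lineDeriv_lineDeriv {E : Type*} [NormedAddCommGroup E]
    [InnerProductSpace ℝ E] [FiniteDimensional ℝ E] [MeasurableSpace E] [BorelSpace E]
    (φ : 𝓢(E, ℂ)) (v w ξ : E) :
    𝓕 (fun x => fderiv ℝ (fun x => fderiv ℝ φ x w) x v) ξ
      = (2 * Real.pi * Complex.I) ^ 2 * (inner ℝ ξ v : ℝ) * (inner ℝ ξ w : ℝ) * 𝓕 φ ξ := by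
  have h : 𝓕 (∂_{v} (∂_{w} φ)) ξ = (2 * Real.pi * Complex.I) ^ 2 * (inner ℝ ξ v : ℝ)
      * (inner ℝ ξ w : ℝ) * 𝓕 φ ξ := by
    rw [SchwartzMap.fourier_lineDerivOp_eq, SchwartzMap.fourier_lineDerivOp_eq]
    have hT : ∀ m : E, (fun x : E => inner ℝ x m).HasTemperateGrowth := fun m => by fun_prop
    simp [SchwartzMap.smulLeftCLM_apply_apply (hT v), SchwartzMap.smulLeftCLM_apply_apply (hT w)]
    ring
  rw [← h, SchwartzMap.fourier_coe]
  rfl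

end FourierLaplacian

/-! ### The regularised, truncated kernel and its Laplacian. -/

section RegularizedGreen
open scoped FourierTransform SchwartzMap ContDiff

/-- The Helmholtz kernel `exp (i κ s) / s`, `s = √(|x|² + ε²)`, with a smooth cutoff. -/
noncomputable def regGreen (κ : ℝ) (b : ContDiffBump (0 : ℝ)) (ε : ℝ) (x : E3) : ℂ :=
  (b (‖x‖ ^ 2) : ℂ) * radialWave κ 1 (‖x‖ ^ 2 + ε ^ 2)

variable (κ : ℝ) (b : ContDiffBump (0 : ℝ)) (ε : ℝ)

theorem ContDiffBump.eq_zero_of_lt {q : ℝ} (hq : b.rOut < q) : b q = 0 :=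
  b.zero_of_le_dist (by rw [Real.dist_eq, sub_zero]; exact hq.le.trans (le_abs_self q))

theorem ContDiffBump.deriv_eq_zero_of_lt {q : ℝ} (hq : b.rOut < q) : deriv b q = 0 := by
  have : b =ᶠ[nhds q] fun _ => 0 := by
    filter_upwards [lt_mem_nhds hq] with t ht using b.eq_zero_of_lt ht
  rw [this.deriv_eq, deriv_const]

theorem ContDiffBump.deriv_deriv_eq_zero_of_lt {q : ℝ} (hq : b.rOut < q) :
    deriv (deriv b) q = 0 := by
  have : deriv b =ᶠ[nhds q] fun _ => 0 := by
    filter_upwards [lt_mem_nhds hq] with t ht using b.deriv_eq_zero_of_lt ht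
  rw [this.deriv_eq, deriv_const]

theorem ContDiffBump.exists_deriv_bound :
    ∃ M, 0 ≤ M ∧ (∀ q, |deriv b q| ≤ M) ∧ ∀ q, |deriv (deriv b) q| ≤ M := by
  have h1 : ContDiff ℝ 1 (deriv b) := (b.contDiff (n := 2)).deriv'
  have h2 : Continuous (deriv (deriv b)) := h1.continuous_deriv le_rfl
  obtain ⟨M₁, hM₁⟩ := b.hasCompactSupport.deriv.exists_bound_of_continuous h1.continuous
  obtain ⟨M₂, hM₂⟩ := b.hasCompactSupport.deriv.deriv.exists_bound_of_continuous h2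
  exact ⟨max M₁ M₂, (abs_nonneg _).trans ((hM₁ 0).trans (le_max_left _ _)),
    fun q => (hM₁ q).trans (le_max_left _ _), fun q => (hM₂ q).trans (le_max_right _ _)⟩

/-- The first derivative of the radial profile of `regGreen` with respect to `|x|²`. -/
noncomputable def regProfile' (q : ℝ) : ℂ :=
  ((deriv b q : ℝ) : ℂ) * radialWave κ 1 (q + ε ^ 2) + (b q : ℂ) *
    (Complex.I * κ / 2 * radialWave κ 2 (q + ε ^ 2) - 1 / 2 * radialWave κ 3 (q + ε ^ 2))

/-- The second derivative of the radial profile of `regGreen` with respect to `|x|²`. -/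
noncomputable def regProfile'' (q : ℝ) : ℂ :=
  (((deriv (deriv b) q : ℝ) : ℂ) * radialWave κ 1 (q + ε ^ 2) + ((deriv b q : ℝ) : ℂ) *
    (Complex.I * κ / 2 * radialWave κ 2 (q + ε ^ 2) - 1 / 2 * radialWave κ 3 (q + ε ^ 2)))
  + (((deriv b q : ℝ) : ℂ) *
    (Complex.I * κ / 2 * radialWave κ 2 (q + ε ^ 2) - 1 / 2 * radialWave κ 3 (q + ε ^ 2))
  + (b q : ℂ) * (-(κ ^ 2 / 4) * radialWave κ 3 (q + ε ^ 2)
      - 3 * Complex.I * κ / 4 * radialWave κ 4 (q + ε ^ 2)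
      + 3 / 4 * radialWave κ 5 (q + ε ^ 2)))

variable {ε}

theorem hasDerivAt_regProfile (hε : 0 < ε) (q : ℝ) (hq : 0 ≤ q) :
    HasDerivAt (fun q => (b q : ℂ) * radialWave κ 1 (q + ε ^ 2)) (regProfile' κ b ε q) q := by
  have hb : HasDerivAt (fun q => (b q : ℂ)) ((deriv b q : ℝ) : ℂ) q :=
    ((b.contDiff (n := 1)).differentiable one_ne_zero q).hasDerivAt.ofReal_comp
  exact hb.mul ((hasDerivAt_radialWave_one κ (by positivity)).comp_add_const q (ε ^ 2))

theorem hasDerivAt_regProfile' (hε : 0 < ε) (q : ℝ) (hq : 0 ≤ q) :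
    HasDerivAt (regProfile' κ b ε) (regProfile'' κ b ε q) q := by
  have hb : HasDerivAt (fun q => (b q : ℂ)) ((deriv b q : ℝ) : ℂ) q :=
    ((b.contDiff (n := 1)).differentiable one_ne_zero q).hasDerivAt.ofReal_comp
  have h1 : ContDiff ℝ 1 (deriv b) := (b.contDiff (n := 2)).deriv'
  have hb' : HasDerivAt (fun q => ((deriv b q : ℝ) : ℂ)) ((deriv (deriv b) q : ℝ) : ℂ) q :=
    (h1.differentiable one_ne_zero q).hasDerivAt.ofReal_comp
  have hp : 0 < q + ε ^ 2 := by positivity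
  exact (hb'.mul ((hasDerivAt_radialWave_one κ hp).comp_add_const q (ε ^ 2))).add
    (hb.mul ((hasDerivAt_radialWave_one_deriv κ hp).comp_add_const q (ε ^ 2)))

/-- The Helmholtz identity holds at `p = q + ε²` with the factor `4 p`, whereas the Laplacian
carries `4 q`; the difference is the `ε²` term. The remaining terms come from derivatives of the
cutoff. -/
theorem regProfile_laplacian (hε : 0 < ε) (q : ℝ) (hq : 0 ≤ q) :
    6 * regProfile' κ b ε q + 4 * q * regProfile'' κ b ε q =
      (b q : ℂ) * (-κ ^ 2 * radialWave κ 1 (q + ε ^ 2))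
      - 4 * ε ^ 2 * (b q : ℂ) * (-(κ ^ 2 / 4) * radialWave κ 3 (q + ε ^ 2)
        - 3 * Complex.I * κ / 4 * radialWave κ 4 (q + ε ^ 2)
        + 3 / 4 * radialWave κ 5 (q + ε ^ 2))
      + (6 * ((deriv b q : ℝ) : ℂ) + 4 * q * ((deriv (deriv b) q : ℝ) : ℂ)) * radialWave κ 1 (q + ε ^ 2)
      + 8 * q * ((deriv b q : ℝ) : ℂ) * (Complex.I * κ / 2 * radialWave κ 2 (q + ε ^ 2)
        - 1 / 2 * radialWave κ 3 (q + ε ^ 2)) := by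
  have h := radialWave_helmholtz κ (p := q + ε ^ 2) (by positivity)
  rw [← h, regProfile', regProfile'']
  push_cast
  ring

/-- The constant does not depend on `ε`: the first part of the bound is integrable in three
dimensions, and the second is the profile of an approximate delta, whose integral is the same for
all `ε`. -/
theorem exists_norm_regProfile_laplacian_le :
    ∃ C, 0 ≤ C ∧ ∀ ε r : ℝ, 0 < ε → 0 < r →
      ‖6 * regProfile' κ b ε (r ^ 2) + 4 * ((r ^ 2 : ℝ) : ℂ) * regProfile'' κ b ε (r ^ 2)‖ ≤
        (if r ≤ 1 + b.rOut then C * (1 + r⁻¹) else 0)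
          + 5 * (ε ^ 2 * (√(r ^ 2 + ε ^ 2) ^ 5)⁻¹) := by
  obtain ⟨M, hM0, hM1, hM2⟩ := b.exists_deriv_bound
  have hout := b.rOut_pos
  -- The four summands bound the undifferentiated cutoff terms, the terms with `M / r`, the term
  -- with `r² M u`, and the mixed term with `M |κ|`, where `u = 1 / √(r² + ε²)`.
  refine ⟨4 * κ ^ 2 + 10 * M + 4 * M * (1 + b.rOut) + 4 * M * |κ|, by positivity, ?_⟩
  intro ε r hε hr
  by_cases hq : b.rOut < r ^ 2
  · rw [regProfile', regProfile'', b.eq_zero_of_lt hq, b.deriv_eq_zero_of_lt hq,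
      b.deriv_deriv_eq_zero_of_lt hq]
    simp only [Complex.ofReal_zero, zero_mul, add_zero, mul_zero, norm_zero]
    split_ifs <;> positivity
  · have hr1 : r ≤ 1 + b.rOut := by nlinarith
    rw [if_pos hr1, regProfile_laplacian κ b hε _ (sq_nonneg r)]
    have hs : 0 < √(r ^ 2 + ε ^ 2) := Real.sqrt_pos.2 (by positivity)
    have hs2 : √(r ^ 2 + ε ^ 2) ^ 2 = r ^ 2 + ε ^ 2 := Real.sq_sqrt (by positivity)
    have hrs : r ≤ √(r ^ 2 + ε ^ 2) := by nlinarith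
    obtain ⟨u, hu⟩ : ∃ u, u = (√(r ^ 2 + ε ^ 2))⁻¹ := ⟨_, rfl⟩
    have hu0 : 0 < u := by rw [hu]; positivity
    have hur : u ≤ r⁻¹ := by rw [hu]; exact inv_anti₀ hr hrs
    have hru : r * u ≤ 1 := by
      calc r * u ≤ r * r⁻¹ := by gcongr
        _ = 1 := mul_inv_cancel₀ hr.ne'
    have hsu : (r ^ 2 + ε ^ 2) * u ^ 2 = 1 := by
      rw [← hs2, hu]; field_simp
    have hq2 : r ^ 2 * u ^ 2 ≤ 1 := by nlinarith [mul_nonneg (sq_nonneg ε) (sq_nonneg u)]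
    have hε2 : ε ^ 2 * u ^ 2 ≤ 1 := by nlinarith [mul_nonneg (sq_nonneg r) (sq_nonneg u)]
    have hw : ∀ n, ‖radialWave κ n (r ^ 2 + ε ^ 2)‖ = u ^ n := fun n => by
      rw [norm_radialWave, hu, inv_pow]
    have hb1 : ‖(b (r ^ 2) : ℂ)‖ ≤ 1 := by
      rw [Complex.norm_real, Real.norm_of_nonneg b.nonneg]; exact b.le_one
    have hb2 : ‖((deriv b (r ^ 2) : ℝ) : ℂ)‖ ≤ M := by rw [Complex.norm_real]; exact hM1 _
    have hb3 : ‖((deriv (deriv b) (r ^ 2) : ℝ) : ℂ)‖ ≤ M := by rw [Complex.norm_real]; exact hM2 _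
    have t1 : ‖(b (r ^ 2) : ℂ) * (-κ ^ 2 * radialWave κ 1 (r ^ 2 + ε ^ 2))‖ ≤ κ ^ 2 * u := by
      have e1 : ‖-(κ : ℂ) ^ 2 * radialWave κ 1 (r ^ 2 + ε ^ 2)‖ = κ ^ 2 * u := by
        rw [norm_mul, hw]; simp
      rw [norm_mul, e1]
      exact mul_le_of_le_one_left (by positivity) hb1
    have t2 : ‖4 * (ε : ℂ) ^ 2 * (b (r ^ 2) : ℂ) * (-(κ ^ 2 / 4) * radialWave κ 3 (r ^ 2 + ε ^ 2)
        - 3 * Complex.I * κ / 4 * radialWave κ 4 (r ^ 2 + ε ^ 2)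
        + 3 / 4 * radialWave κ 5 (r ^ 2 + ε ^ 2))‖ ≤
        4 * ε ^ 2 * (κ ^ 2 / 4 * u ^ 3 + 3 * |κ| / 4 * u ^ 4 + 3 / 4 * u ^ 5) := by
      rw [norm_mul, norm_mul]
      have e1 : ‖4 * (ε : ℂ) ^ 2‖ = 4 * ε ^ 2 := by simp
      rw [e1]
      refine mul_le_mul (mul_le_of_le_one_right (by positivity) hb1) ?_ (norm_nonneg _)
        (by positivity)
      refine (norm_add_le _ _).trans (add_le_add ((norm_sub_le _ _).trans (add_le_add ?_ ?_)) ?_)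
      · rw [norm_mul, hw]; simp
      · rw [norm_mul, hw]; simp
      · rw [norm_mul, hw]; simp
    have t3 : ‖(6 * ((deriv b (r ^ 2) : ℝ) : ℂ) + 4 * ((r ^ 2 : ℝ) : ℂ) * ((deriv (deriv b) (r ^ 2) : ℝ) : ℂ))
        * radialWave κ 1 (r ^ 2 + ε ^ 2)‖ ≤ (6 * M + 4 * r ^ 2 * M) * u := by
      rw [norm_mul, hw, pow_one]
      gcongr
      refine (norm_add_le _ _).trans (add_le_add ?_ ?_)
      · rw [norm_mul, Complex.norm_ofNat]; gcongr
      · rw [norm_mul, norm_mul, Complex.norm_ofNat, Complex.norm_real,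
          Real.norm_of_nonneg (sq_nonneg r)]
        gcongr
    have t4 : ‖8 * ((r ^ 2 : ℝ) : ℂ) * ((deriv b (r ^ 2) : ℝ) : ℂ)
        * (Complex.I * κ / 2 * radialWave κ 2 (r ^ 2 + ε ^ 2)
        - 1 / 2 * radialWave κ 3 (r ^ 2 + ε ^ 2))‖ ≤
        8 * r ^ 2 * M * (|κ| / 2 * u ^ 2 + 1 / 2 * u ^ 3) := by
      rw [norm_mul, norm_mul, norm_mul, Complex.norm_ofNat, Complex.norm_real,
          Real.norm_of_nonneg (sq_nonneg r)]
      gcongr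
      refine (norm_sub_le _ _).trans (add_le_add ?_ ?_)
      · rw [norm_mul, hw]; simp
      · rw [norm_mul, hw]; simp
    have e5 : (√(r ^ 2 + ε ^ 2) ^ 5)⁻¹ = u ^ 5 := by rw [hu, inv_pow]
    rw [e5]
    have s1 : ε ^ 2 * u ^ 3 ≤ u := by nlinarith
    -- The middle power `u⁴` is split between `u³` and `u⁵` by the arithmetic-geometric mean
    -- inequality. The coefficient of `ε² u⁵` becomes `3 + 3/2`, which is below the `5` of the
    -- statement.
    have s2 : 2 * (|κ| * (ε ^ 2 * u ^ 4)) ≤ κ ^ 2 * (ε ^ 2 * u ^ 3) + ε ^ 2 * u ^ 5 := by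
      have : 0 ≤ ε ^ 2 * u ^ 3 * (|κ| - u) ^ 2 := by positivity
      rw [← sq_abs κ]
      linarith
    have s3 : κ ^ 2 * (ε ^ 2 * u ^ 3) ≤ κ ^ 2 * u := by gcongr
    have s4 : r ^ 2 * M * u ≤ M * (1 + b.rOut) := by
      calc r ^ 2 * M * u = M * r * (r * u) := by ring
        _ ≤ M * r * 1 := by gcongr
        _ ≤ M * (1 + b.rOut) := by rw [mul_one]; gcongr
    have s5 : r ^ 2 * M * (|κ| * u ^ 2) ≤ M * |κ| := by
      calc r ^ 2 * M * (|κ| * u ^ 2) = M * |κ| * (r ^ 2 * u ^ 2) := by ring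
        _ ≤ M * |κ| := mul_le_of_le_one_right (by positivity) hq2
    have s6 : r ^ 2 * M * u ^ 3 ≤ M * u := by
      calc r ^ 2 * M * u ^ 3 = M * u * (r ^ 2 * u ^ 2) := by ring
        _ ≤ M * u := mul_le_of_le_one_right (by positivity) hq2
    have s7 : κ ^ 2 * u ≤ κ ^ 2 * r⁻¹ := by gcongr
    have s8 : M * u ≤ M * r⁻¹ := by gcongr
    have hri : 0 ≤ r⁻¹ := by positivity
    have n1 : 0 ≤ κ ^ 2 * r⁻¹ := by positivity
    have n2 : 0 ≤ M * (1 + b.rOut) * r⁻¹ := by positivity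
    have n3 : 0 ≤ M * |κ| * r⁻¹ := by positivity
    have n4 : 0 ≤ κ ^ 2 := by positivity
    have n5 : 0 ≤ ε ^ 2 * u ^ 5 := by positivity
    refine (norm_add_le _ _).trans ((add_le_add ((norm_add_le _ _).trans
      (add_le_add ((norm_sub_le _ _).trans (add_le_add t1 t2)) t3)) t4).trans ?_)
    nlinarith

end RegularizedGreen

/-! ### Quadratic decay of the Fourier transform of the truncated kernel. -/

section FourierGreen
open scoped FourierTransform SchwartzMap ContDiff

/-- In polar coordinates the Jacobian `r²` turns `1 + 1/r` into `r² + r`. -/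
theorem integrable_indicator_one_add_inv_norm (C ρ : ℝ) :
    Integrable (fun x : E3 => if ‖x‖ ≤ ρ then C * (1 + ‖x‖⁻¹) else 0) := by
  refine (integrable_fun_norm_addHaar (E := E3) volume
    (f := fun r => if r ≤ ρ then C * (1 + r⁻¹) else 0)).2 ?_
  have h : IntegrableOn (fun y : ℝ => C * (y ^ 2 + y)) (Set.Icc 0 ρ) :=
    Continuous.integrableOn_Icc (by fun_prop)
  have h2 : Integrable ((Set.Icc 0 ρ).indicator fun y : ℝ => C * (y ^ 2 + y)) :=
    (integrable_indicator_iff measurableSet_Icc).2 h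
  refine h2.integrableOn.congr_fun ?_ measurableSet_Ioi
  intro y hy
  have hy0 : (0 : ℝ) < y := hy
  simp only [finrank_euclideanSpace, Fintype.card_fin, smul_eq_mul, Set.indicator, Set.mem_Icc,
    hy0.le, true_and, Nat.add_one_sub_one]
  split_ifs
  · field_simp
  · simp

theorem integrable_inv_sqrt_pow_five :
    Integrable (fun x : E3 => (√(‖x‖ ^ 2 + 1) ^ 5)⁻¹) := by
  have h := integrable_rpow_neg_one_add_norm_sq (E := E3) (μ := volume) (r := 5)
    (by simp; norm_num)
  refine h.congr (Filter.Eventually.of_forall fun x => ?_)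
  have hp : (0 : ℝ) ≤ 1 + ‖x‖ ^ 2 := by positivity
  simp only
  rw [add_comm (‖x‖ ^ 2), Real.sqrt_eq_rpow, ← Real.rpow_natCast _ 5, ← Real.rpow_mul hp,
    ← Real.rpow_neg hp]
  norm_num

/-- This is the scaling `ε⁻³ Φ(x / ε)` of a fixed profile, which preserves integrals in dimension
three. -/
theorem scaled_inv_sqrt_pow_five {ε : ℝ} (hε : 0 < ε) (x : E3) :
    ε ^ 2 * (√(‖x‖ ^ 2 + ε ^ 2) ^ 5)⁻¹ =
      (ε ^ 3)⁻¹ * (√(‖ε⁻¹ • x‖ ^ 2 + 1) ^ 5)⁻¹ := by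
  have h : ‖ε⁻¹ • x‖ ^ 2 + 1 = (‖x‖ ^ 2 + ε ^ 2) / ε ^ 2 := by
    rw [norm_smul, Real.norm_of_nonneg (by positivity)]
    field_simp
  rw [h, Real.sqrt_div (by positivity), Real.sqrt_sq hε.le]
  have : √(‖x‖ ^ 2 + ε ^ 2) ≠ 0 := (Real.sqrt_pos.2 (by positivity)).ne'
  field_simp

theorem integrable_scaled_inv_sqrt_pow_five {ε : ℝ} (hε : 0 < ε) :
    Integrable (fun x : E3 => ε ^ 2 * (√(‖x‖ ^ 2 + ε ^ 2) ^ 5)⁻¹) := by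
  simp_rw [scaled_inv_sqrt_pow_five hε]
  exact (integrable_inv_sqrt_pow_five.comp_smul (inv_ne_zero hε.ne')).const_mul _

theorem integral_scaled_inv_sqrt_pow_five {ε : ℝ} (hε : 0 < ε) :
    ∫ x : E3, ε ^ 2 * (√(‖x‖ ^ 2 + ε ^ 2) ^ 5)⁻¹ = ∫ x : E3, (√(‖x‖ ^ 2 + 1) ^ 5)⁻¹ := by
  simp_rw [scaled_inv_sqrt_pow_five hε]
  rw [integral_const_mul, Measure.integral_comp_smul_of_nonneg volume
    (fun x : E3 => (√(‖x‖ ^ 2 + 1) ^ 5)⁻¹) _ (hR := by positivity)]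
  simp only [finrank_euclideanSpace, Fintype.card_fin, smul_eq_mul]
  field_simp

variable (κ : ℝ) (b : ContDiffBump (0 : ℝ))

theorem contDiffAt_radialWave (n : ℕ) {p : ℝ} (hp : 0 < p) :
    ContDiffAt ℝ ∞ (radialWave κ n) p := by
  have h1 : ContDiffAt ℝ ∞ (fun p : ℝ => ((√p : ℝ) : ℂ)) p :=
    Complex.ofRealCLM.contDiff.contDiffAt.comp p (Real.contDiffAt_sqrt hp.ne')
  have h2 : ContDiffAt ℝ ∞ (fun p : ℝ => Complex.exp (Complex.I * (κ * √p : ℝ))) p := by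
    simp only [Complex.ofReal_mul]
    exact (contDiffAt_const.mul (contDiffAt_const.mul h1)).cexp
  have hs' : ((√p : ℝ) : ℂ) ≠ 0 := by exact_mod_cast (Real.sqrt_pos.2 hp).ne'
  exact h2.mul ((h1.pow n).inv (pow_ne_zero n hs'))

theorem contDiffAt_regGreen {ε : ℝ} {x : E3} (h : 0 < ‖x‖ ^ 2 + ε ^ 2) :
    ContDiffAt ℝ ∞ (regGreen κ b ε) x := by
  have hn : ContDiffAt ℝ ∞ (fun x : E3 => ‖x‖ ^ 2) x := (contDiff_norm_sq ℝ).contDiffAt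
  refine ContDiffAt.mul ?_ ?_
  · exact Complex.ofRealCLM.contDiff.contDiffAt.comp x
      (b.contDiff.contDiffAt.comp x hn)
  · exact (contDiffAt_radialWave κ 1 h).comp x (hn.add contDiffAt_const)

theorem contDiff_regGreen {ε : ℝ} (hε : 0 < ε) : ContDiff ℝ ∞ (regGreen κ b ε) :=
  contDiff_iff_contDiffAt.2 fun x => contDiffAt_regGreen κ b (by positivity)

theorem regGreen_eq_zero {ε : ℝ} {x : E3} (hx : b.rOut < ‖x‖ ^ 2) : regGreen κ b ε x = 0 := by
  rw [regGreen, b.eq_zero_of_lt hx, Complex.ofReal_zero, zero_mul]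

theorem hasCompactSupport_regGreen (ε : ℝ) : HasCompactSupport (regGreen κ b ε) := by
  refine HasCompactSupport.intro (isCompact_closedBall (0 : E3) (1 + b.rOut)) fun x hx => ?_
  refine regGreen_eq_zero κ b ?_
  rw [mem_closedBall_zero_iff, not_le] at hx
  nlinarith [b.rOut_pos]

theorem norm_regGreen_le (ε : ℝ) {x : E3} (hx : x ≠ 0) :
    ‖regGreen κ b ε x‖ ≤ if ‖x‖ ≤ 1 + b.rOut then 1 * (1 + ‖x‖⁻¹) else 0 := by
  have hout := b.rOut_pos
  have hr : 0 < ‖x‖ := norm_pos_iff.2 hx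
  split_ifs with h
  · rw [regGreen, norm_mul, norm_radialWave, Complex.norm_real, Real.norm_of_nonneg b.nonneg,
      pow_one]
    have : (√(‖x‖ ^ 2 + ε ^ 2))⁻¹ ≤ ‖x‖⁻¹ :=
      inv_anti₀ hr (Real.le_sqrt_of_sq_le (by nlinarith [sq_nonneg ε]))
    calc _ ≤ 1 * ‖x‖⁻¹ := mul_le_mul b.le_one this (by positivity) zero_le_one
      _ ≤ _ := by linarith
  · rw [regGreen_eq_zero κ b (by nlinarith), norm_zero]

theorem ae_ne_zero_E3 : ∀ᵐ x : E3, x ≠ 0 := by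
  simp [ae_iff]

theorem measurable_regGreen (ε : ℝ) : Measurable (regGreen κ b ε) := by
  unfold regGreen radialWave
  have := b.continuous.measurable
  fun_prop

theorem integrable_regGreen (ε : ℝ) : Integrable (regGreen κ b ε) := by
  refine (integrable_indicator_one_add_inv_norm 1 (1 + b.rOut)).mono'
    (measurable_regGreen κ b ε).aestronglyMeasurable ?_
  filter_upwards [ae_ne_zero_E3] with x hx using norm_regGreen_le κ b ε hx

/-- Dominated convergence, with the majorant of `norm_regGreen_le`, which is free of `ε`. -/
theorem tendsto_fourier_regGreen (ξ : E3) :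
    Filter.Tendsto (fun ε => 𝓕 (regGreen κ b ε) ξ) (nhdsWithin 0 (Set.Ioi 0))
      (nhds (𝓕 (regGreen κ b 0) ξ)) := by
  simp only [Real.fourier_eq]
  refine tendsto_integral_filter_of_dominated_convergence
    (fun x => if ‖x‖ ≤ 1 + b.rOut then 1 * (1 + ‖x‖⁻¹) else 0) ?_ ?_
    (integrable_indicator_one_add_inv_norm 1 (1 + b.rOut)) ?_
  · refine Filter.Eventually.of_forall fun ε => ?_
    exact ((Real.fourierIntegral_convergent_iff ξ).2
      (integrable_regGreen κ b ε)).aestronglyMeasurable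
  · refine Filter.Eventually.of_forall fun ε => ?_
    filter_upwards [ae_ne_zero_E3] with x hx
    rw [Circle.norm_smul]
    exact norm_regGreen_le κ b ε hx
  · filter_upwards [ae_ne_zero_E3] with x hx
    refine Filter.Tendsto.const_smul ?_ _
    have hr : 0 < ‖x‖ ^ 2 + 0 ^ 2 := by have := norm_pos_iff.2 hx; positivity
    have hc : ContinuousAt (fun ε : ℝ => regGreen κ b ε x) 0 := by
      refine continuousAt_const.mul ?_
      exact ContinuousAt.comp (f := fun ε : ℝ => ‖x‖ ^ 2 + ε ^ 2)
        (contDiffAt_radialWave κ 1 hr).continuousAt (by fun_prop)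
    exact hc.tendsto.mono_left nhdsWithin_le_nhds

/-- For `ε > 0` the kernel is smooth with compact support, hence a Schwartz function; the function
on the left is its Laplacian, the sum of three pure second derivatives. -/
theorem fourier_laplacian_regGreen {ε : ℝ} (hε : 0 < ε) (ξ : E3) :
    𝓕 (fun x : E3 => 6 * regProfile' κ b ε (‖x‖ ^ 2)
      + 4 * ((‖x‖ ^ 2 : ℝ) : ℂ) * regProfile'' κ b ε (‖x‖ ^ 2)) ξ =
      (2 * Real.pi * Complex.I) ^ 2 * ((‖ξ‖ ^ 2 : ℝ) : ℂ) * 𝓕 (regGreen κ b ε) ξ := by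
  let φ : 𝓢(E3, ℂ) := (hasCompactSupport_regGreen κ b ε).toSchwartzMap (contDiff_regGreen κ b hε)
  have hφ : (φ : E3 → ℂ) = regGreen κ b ε := rfl
  have h := fun i => SchwartzMap.fourier_lineDeriv_lineDeriv φ (basisVec i) (basisVec i) ξ
  have hint : ∀ i, Integrable
      (fun x => fderiv ℝ (fun x => fderiv ℝ φ x (basisVec i)) x (basisVec i)) := fun i =>
    (LineDeriv.lineDerivOp (basisVec i) (LineDeriv.lineDerivOp (basisVec i) φ)).integrable
  have hnorm : ∀ x : E3, ∑ i, ((inner ℝ x (basisVec i) : ℝ) : ℂ) ^ 2 = ((‖x‖ ^ 2 : ℝ) : ℂ) := by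
    intro x
    rw [EuclideanSpace.real_norm_sq_eq]
    simp [basisVec, EuclideanSpace.inner_single_right]
  have hsum : (fun x : E3 => 6 * regProfile' κ b ε (‖x‖ ^ 2)
      + 4 * ((‖x‖ ^ 2 : ℝ) : ℂ) * regProfile'' κ b ε (‖x‖ ^ 2)) =
      fun x => ∑ i, fderiv ℝ (fun x => fderiv ℝ φ x (basisVec i)) x (basisVec i) := by
    ext x
    rw [hφ]
    unfold regGreen
    simp_rw [fderiv_fderiv_comp_norm_sq (hasDerivAt_regProfile κ b hε)
      (hasDerivAt_regProfile' κ b hε)]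
    rw [Finset.sum_add_distrib, ← Finset.mul_sum, ← Finset.mul_sum, hnorm]
    simp [basisVec]
    ring
  have e1 : 𝓕 (fun x => ∑ i, fderiv ℝ (fun x => fderiv ℝ φ x (basisVec i)) x (basisVec i)) ξ
      = ∑ i, 𝓕 (fun x => fderiv ℝ (fun x => fderiv ℝ φ x (basisVec i)) x (basisVec i)) ξ := by
    simp only [Real.fourier_eq, Finset.smul_sum]
    exact integral_finsetSum _ fun i _ => (Real.fourierIntegral_convergent_iff ξ).2 (hint i)
  rw [hsum, e1, Finset.sum_congr rfl fun i _ => h i, SchwartzMap.fourier_coe, hφ, ← hnorm]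
  rw [Finset.mul_sum, Finset.sum_mul]
  exact Finset.sum_congr rfl fun i _ => by ring

/-- The Fourier transform of the truncated Helmholtz kernel decays quadratically. -/
theorem exists_sq_norm_mul_fourier_regGreen_le :
    ∃ C, ∀ ξ : E3, ‖ξ‖ ^ 2 * ‖𝓕 (regGreen κ b 0) ξ‖ ≤ C := by
  obtain ⟨C, hC0, hC⟩ := exists_norm_regProfile_laplacian_le κ b
  set C' : ℝ := (∫ x : E3, if ‖x‖ ≤ 1 + b.rOut then C * (1 + ‖x‖⁻¹) else 0)
    + 5 * ∫ x : E3, (√(‖x‖ ^ 2 + 1) ^ 5)⁻¹ with hC'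
  refine ⟨((2 * Real.pi) ^ 2)⁻¹ * C', fun ξ => ?_⟩
  -- `C'` bounds the `L¹` norm of the Laplacian for every `ε > 0`, so the estimate survives the
  -- limit `ε → 0`, where the kernel itself is singular.
  refine le_of_tendsto ((tendsto_fourier_regGreen κ b ξ).norm.const_mul (‖ξ‖ ^ 2)) ?_
  filter_upwards [self_mem_nhdsWithin] with ε hε
  have hε' : 0 < ε := hε
  have h := congrArg norm (fourier_laplacian_regGreen κ b hε' ξ)
  have hn : ‖(2 * Real.pi * Complex.I : ℂ)‖ = 2 * Real.pi := by
    simp [abs_of_pos Real.pi_pos]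
  rw [norm_mul, norm_mul, norm_pow, hn, Complex.norm_real,
    Real.norm_of_nonneg (sq_nonneg ‖ξ‖)] at h
  have hle : (2 * Real.pi) ^ 2 * ‖ξ‖ ^ 2 * ‖𝓕 (regGreen κ b ε) ξ‖ ≤ C' := by
    rw [← h, Real.fourier_eq]
    refine (norm_integral_le_of_norm_le (g := fun x => (if ‖x‖ ≤ 1 + b.rOut then
      C * (1 + ‖x‖⁻¹) else 0) + 5 * (ε ^ 2 * (√(‖x‖ ^ 2 + ε ^ 2) ^ 5)⁻¹)) ?_ ?_).trans_eq ?_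
    · exact (integrable_indicator_one_add_inv_norm C _).add
        ((integrable_scaled_inv_sqrt_pow_five hε').const_mul 5)
    · filter_upwards [ae_ne_zero_E3] with x hx
      rw [Circle.norm_smul]
      exact hC ε ‖x‖ hε' (norm_pos_iff.2 hx)
    · rw [integral_add (integrable_indicator_one_add_inv_norm C _)
        ((integrable_scaled_inv_sqrt_pow_five hε').const_mul 5), integral_const_mul,
        integral_scaled_inv_sqrt_pow_five hε']
  rw [inv_mul_eq_div, le_div_iff₀ (by positivity)]
  linarith

end FourierGreen

/-! ### Interior smoothness of potentials and integration by parts. -/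

section Potential
open scoped FourierTransform SchwartzMap ContDiff Convolution

/-- The potential `y ↦ ∫ Γ(y - z) g(z) dz`. -/
noncomputable def potential (Γ g : E3 → ℂ) (y : E3) : ℂ := ∫ z, Γ (y - z) * g z

theorem potential_eq_convolution_real (Γ g : E3 → ℂ) :
    potential Γ g = Γ ⋆[ContinuousLinearMap.mul ℝ ℂ, volume] g := by
  ext y
  rw [convolution_eq_swap]
  rfl

theorem potential_eq_convolution (Γ g : E3 → ℂ) :
    potential Γ g = Γ ⋆[ContinuousLinearMap.mul ℂ ℂ, volume] g := by
  ext y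
  rw [convolution_eq_swap]
  rfl

theorem integrable_potential {Γ g : E3 → ℂ} (hΓ : Integrable Γ) (hg : Integrable g) :
    Integrable (potential Γ g) := by
  rw [potential_eq_convolution]
  exact hΓ.integrable_convolution _ hg

theorem fourier_potential {Γ g : E3 → ℂ} (hΓ : Integrable Γ) (hg : Integrable g) (ξ : E3) :
    𝓕 (potential Γ g) ξ = 𝓕 Γ ξ * 𝓕 g ξ := by
  rw [potential_eq_convolution]
  exact Real.fourier_mul_convolution_eq hΓ hg ξ

theorem contDiff_one_sub_bump_mul {Γ : E3 → ℂ} (hΓ : ∀ x ≠ 0, ContDiffAt ℝ ∞ Γ x)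
    (ζ : ContDiffBump (0 : E3)) : ContDiff ℝ ∞ (fun x => ((1 - ζ x : ℝ) : ℂ) * Γ x) := by
  refine contDiff_iff_contDiffAt.2 fun x => ?_
  rcases eq_or_ne x 0 with rfl | hx
  · have : (fun x => ((1 - ζ x : ℝ) : ℂ) * Γ x) =ᶠ[nhds 0] fun _ => 0 := by
      filter_upwards [ζ.eventuallyEq_one] with x hx
      simp [hx]
    exact contDiffAt_const.congr_of_eventuallyEq this
  · exact (Complex.ofRealCLM.contDiff.contDiffAt.comp x
      (contDiffAt_const.sub ζ.contDiffAt)).mul (hΓ x hx)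

/-- The potential of a smooth density on an open set is smooth there. -/
theorem contDiffAt_potential {Ω : Set E3} (hΩ : IsOpen Ω) (hΩb : Bornology.IsBounded Ω)
    {Γ g : E3 → ℂ} (hΓi : Integrable Γ) (hΓc : HasCompactSupport Γ)
    (hΓ : ∀ x ≠ 0, ContDiffAt ℝ ∞ Γ x) (hg : ContDiff ℝ ∞ g) (hgb : ∃ M, ∀ x, ‖g x‖ ≤ M)
    {y : E3} (hy : y ∈ Ω) : ContDiffAt ℝ ∞ (potential Γ (Ω.indicator g)) y := by
  obtain ⟨R, hR, hRΩ⟩ := Metric.isOpen_iff.1 hΩ y hy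
  obtain ⟨M, hM⟩ := hgb
  -- The density is split into `g₁ = η g`, smooth with compact support, and `g₂`, which vanishes
  -- within `R / 2` of `y`. For `x` within `R / 4` of `y` only arguments of `Γ` of norm at least `R
  -- / 4` meet `g₂`, and there `Γ` equals the smooth `Γ₂ = (1 - ζ) Γ`.
  let η : ContDiffBump y := ⟨R / 2, 3 * R / 4, by positivity, by linarith⟩
  let ζ : ContDiffBump (0 : E3) := ⟨R / 8, R / 4, by positivity, by linarith⟩
  let g₁ : E3 → ℂ := fun z => ((η z : ℝ) : ℂ) * g z
  let g₂ : E3 → ℂ := fun z => Ω.indicator g z - g₁ z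
  let Γ₂ : E3 → ℂ := fun x => ((1 - ζ x : ℝ) : ℂ) * Γ x
  have hg₁c : HasCompactSupport g₁ :=
    (η.hasCompactSupport.comp_left (g := ((↑) : ℝ → ℂ)) Complex.ofReal_zero).mul_right
  have hg₁ : ContDiff ℝ ∞ g₁ := (Complex.ofRealCLM.contDiff.comp η.contDiff).mul hg
  have hΩi : Integrable (Ω.indicator g) := by
    refine (integrable_indicator_iff hΩ.measurableSet).2 ?_
    exact Measure.integrableOn_of_bounded hΩb.measure_lt_top.ne
      hg.continuous.aestronglyMeasurable (Filter.Eventually.of_forall hM)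
  have hg₁i : Integrable g₁ := hg₁.continuous.integrable_of_hasCompactSupport hg₁c
  have hg₂i : Integrable g₂ := hΩi.sub hg₁i
  have h1 : ContDiff ℝ ∞ (potential Γ g₁) := by
    rw [potential_eq_convolution_real]
    exact hg₁c.contDiff_convolution_right _ hΓi.locallyIntegrable hg₁
  have h2 : ContDiff ℝ ∞ (potential Γ₂ g₂) := by
    rw [potential_eq_convolution_real]
    exact (hΓc.mul_left).contDiff_convolution_left _ (contDiff_one_sub_bump_mul hΓ ζ)
      hg₂i.locallyIntegrable
  refine (h1.add h2).contDiffAt.congr_of_eventuallyEq ?_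
  filter_upwards [Metric.ball_mem_nhds y (show (0 : ℝ) < R / 4 by positivity)] with x hx
  have e2 : ∀ z, Γ₂ (x - z) * g₂ z = Γ (x - z) * g₂ z := by
    intro z
    by_cases hz : z ∈ Metric.closedBall y (R / 2)
    · have h3 : η z = 1 := η.one_of_mem_closedBall hz
      have h4 : z ∈ Ω := hRΩ (Metric.closedBall_subset_ball (by linarith) hz)
      simp [g₂, g₁, h3, h4]
    · have h5 : ζ (x - z) = 0 := by
        refine ζ.zero_of_le_dist ?_
        rw [Metric.mem_closedBall, not_le] at hz
        rw [Metric.mem_ball] at hx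
        change R / 4 ≤ _
        rw [dist_zero_right, ← dist_eq_norm]
        linarith [dist_triangle_left z y x]
      simp [Γ₂, h5]
  have hi1 : Integrable (fun z => Γ (x - z) * g₁ z) := by
    have := hg₁i.1
    refine (hΓi.comp_sub_left x).mul_bdd (c := M) this (Filter.Eventually.of_forall fun z => ?_)
    simp only [g₁, norm_mul, Complex.norm_real, Real.norm_of_nonneg η.nonneg]
    exact (mul_le_of_le_one_left (norm_nonneg _) η.le_one).trans (hM z)
  have hi2 : Integrable (fun z => Γ (x - z) * Ω.indicator g z) := by
    refine (hΓi.comp_sub_left x).mul_bdd (c := M) hΩi.1 (Filter.Eventually.of_forall fun z => ?_)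
    exact (norm_indicator_le_norm_self _ _).trans (hM z)
  have hi3 : Integrable (fun z => Γ (x - z) * g₂ z) := by
    simp only [g₂, mul_sub]
    exact hi2.sub hi1
  simp only [potential]
  simp_rw [e2]
  rw [← integral_add hi1 hi3]
  refine integral_congr_ae (Filter.Eventually.of_forall fun z => ?_)
  simp only [g₂]
  ring

/-- Nothing is known about `h` outside `Ω`, but `φ` vanishes near every point outside its support,
so the product is continuous everywhere. -/
theorem integrable_mul_of_tsupport_subset {Ω : Set E3} {φ h : E3 → ℂ}
    (hφ : Continuous φ) (hφc : HasCompactSupport φ) (hφΩ : tsupport φ ⊆ Ω)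
    (hh : ∀ x ∈ Ω, ContinuousAt h x) : Integrable (fun x => φ x * h x) := by
  have hc : Continuous (fun x => φ x * h x) := by
    refine continuous_iff_continuousAt.2 fun x => ?_
    by_cases hx : x ∈ tsupport φ
    · exact hφ.continuousAt.mul (hh x (hφΩ hx))
    · have : (fun x => φ x * h x) =ᶠ[nhds x] fun _ => 0 := by
        filter_upwards [(isClosed_tsupport φ).isOpen_compl.mem_nhds hx] with z hz
        rw [image_eq_zero_of_notMem_tsupport hz, zero_mul]
      exact continuousAt_const.congr this.symm
  exact hc.integrable_of_hasCompactSupport hφc.mul_right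

theorem integral_mul_fderiv_eq_neg {Ω : Set E3} {φ u : E3 → ℂ} (v : E3)
    (hφ : ContDiff ℝ ∞ φ) (hφc : HasCompactSupport φ) (hφΩ : tsupport φ ⊆ Ω)
    (hu : ∀ x ∈ Ω, ContDiffAt ℝ ∞ u x) :
    ∫ x, φ x * fderiv ℝ u x v = -∫ x, fderiv ℝ φ x v * u x := by
  have hc : ∀ x ∈ Ω, ContinuousAt u x := fun x hx => (hu x hx).continuousAt
  refine integral_mul_fderiv_eq_neg_fderiv_mul_of_integrable ?_ ?_ ?_ ?_ ?_
  · refine integrable_mul_of_tsupport_subset (Ω := Ω) ?_ (hφc.fderiv_apply ℝ v) ?_ hc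
    · exact (hφ.continuous_fderiv (by simp)).clm_apply continuous_const
    · exact (tsupport_fderiv_apply_subset ℝ v).trans hφΩ
  · refine integrable_mul_of_tsupport_subset (Ω := Ω) hφ.continuous hφc hφΩ fun x hx => ?_
    exact ((hu x hx).fderiv_right (m := ∞) (by simp)).continuousAt.clm_apply continuousAt_const
  · exact integrable_mul_of_tsupport_subset hφ.continuous hφc hφΩ hc
  · exact fun x _ => (hφ.differentiable (by simp)) x
  · exact fun x hx => (hu x (hφΩ hx)).differentiableAt (by simp)

theorem integral_mul_fderiv_fderiv {Ω : Set E3} {φ u : E3 → ℂ} (v w : E3)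
    (hφ : ContDiff ℝ ∞ φ) (hφc : HasCompactSupport φ) (hφΩ : tsupport φ ⊆ Ω)
    (hu : ∀ x ∈ Ω, ContDiffAt ℝ ∞ u x) :
    ∫ x, φ x * fderiv ℝ (fun x => fderiv ℝ u x w) x v =
      ∫ x, fderiv ℝ (fun x => fderiv ℝ φ x v) x w * u x := by
  rw [integral_mul_fderiv_eq_neg v hφ hφc hφΩ fun x hx => ?_,
    integral_mul_fderiv_eq_neg w ?_ (hφc.fderiv_apply ℝ v)
      ((tsupport_fderiv_apply_subset ℝ v).trans hφΩ) hu, neg_neg]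
  · exact (hφ.fderiv_right (m := ∞) (by simp)).clm_apply contDiff_const
  · exact ((hu x hx).fderiv_right (m := ∞) (by simp)).clm_apply contDiffAt_const

end Potential

/-! ### The Green tensor as a bounded Fourier multiplier. -/

section Multiplier
open scoped FourierTransform SchwartzMap LineDeriv

/-- The Fourier multiplier with the bounded symbol `m`. -/
noncomputable def fourierMultL2 (m : Lp ℂ ∞ (volume : Measure E3)) :
    Lp ℂ 2 (volume : Measure E3) →L[ℂ] Lp ℂ 2 (volume : Measure E3) :=
  ((Lp.fourierTransformₗᵢ E3 ℂ).symm.toContinuousLinearEquiv : _ →L[ℂ] _) ∘L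
    ((ContinuousLinearMap.mul ℂ ℂ).holderL volume ∞ 2 2 m) ∘L
    ((Lp.fourierTransformₗᵢ E3 ℂ).toContinuousLinearEquiv : _ →L[ℂ] _)

theorem fourierMultL2_apply (m : Lp ℂ ∞ (volume : Measure E3))
    (f : Lp ℂ 2 (volume : Measure E3)) :
    fourierMultL2 m f = 𝓕⁻ ((ContinuousLinearMap.mul ℂ ℂ).holder 2 m (𝓕 f)) := rfl

theorem pairL2_fourierMultL2 {m : E3 → ℂ} (hm : MemLp m ∞) {a g : E3 → ℂ} (ha1 : Integrable a)
    (ha2 : MemLp a 2) (hg1 : Integrable g) (hg2 : MemLp g 2) :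
    pairL2 volume (ha2.toLp a) (fourierMultL2 (hm.toLp m) (hg2.toLp g)) =
      ∫ ξ, 𝓕 a (-ξ) * (m ξ * 𝓕 g ξ) := by
  rw [fourierMultL2_apply, pairL2_fourierInv, pairL2_apply]
  refine integral_congr_ae ?_
  filter_upwards [fourierInv_toLp_ae_eq ha1 ha2, fourier_toLp_ae_eq hg1 hg2, hm.coeFn_toLp,
    ContinuousLinearMap.coeFn_holder (r := 2) (ContinuousLinearMap.mul ℂ ℂ) (hm.toLp m)
      (𝓕 (hg2.toLp g))] with ξ h1 h2 h3 h4
  rw [h1, h4, h2, h3]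
  rfl

/-- A Fourier multiplier with even symbol is symmetric. -/
theorem pairL2_fourierMultL2_comm {m : E3 → ℂ} (hm : MemLp m ∞) (hme : ∀ ξ, m (-ξ) = m ξ)
    {a g : E3 → ℂ} (ha1 : Integrable a)
    (ha2 : MemLp a 2) (hg1 : Integrable g) (hg2 : MemLp g 2) :
    pairL2 volume (ha2.toLp a) (fourierMultL2 (hm.toLp m) (hg2.toLp g)) =
      pairL2 volume (hg2.toLp g) (fourierMultL2 (hm.toLp m) (ha2.toLp a)) := by
  -- Both pairings become frequency integrals in which the substitution `ξ ↦ -ξ` exchanges `a` and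
  -- `g`.
  rw [pairL2_fourierMultL2 hm ha1 ha2 hg1 hg2, pairL2_fourierMultL2 hm hg1 hg2 ha1 ha2,
    ← integral_neg_eq_self]
  refine integral_congr_ae (Filter.Eventually.of_forall fun ξ => ?_)
  simp only [neg_neg, hme]
  ring

/-- Each derivative contributes `-2πi`; two of them give the same factor `(2πi)²` as in
`greenSymbol`. -/
theorem SchwartzMap.fourierInv_lineDeriv_lineDeriv (φ : 𝓢(E3, ℂ)) (v w ξ : E3) :
    𝓕⁻ (∂_{w} (∂_{v} φ)) ξ
      = (2 * Real.pi * Complex.I) ^ 2 * (inner ℝ ξ v : ℝ) * (inner ℝ ξ w : ℝ) * 𝓕⁻ φ ξ := by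
  have hT : ∀ m : E3, (fun x : E3 => inner ℝ x m).HasTemperateGrowth := fun m => by fun_prop
  rw [SchwartzMap.fourierInv_lineDerivOp_eq, SchwartzMap.fourierInv_lineDerivOp_eq]
  simp [SchwartzMap.smulLeftCLM_apply_apply (hT v), SchwartzMap.smulLeftCLM_apply_apply (hT w)]
  ring

variable (ω c : ℝ) (b : ContDiffBump (0 : ℝ))

/-- The truncated Green function. -/
noncomputable def greenCut (x : E3) : ℂ := (4 * Real.pi : ℂ)⁻¹ * regGreen (ω / c) b 0 x

theorem greenFn_eq_greenCut {x : E3} (hx : ‖x‖ ^ 2 ≤ b.rIn) :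
    greenFn ω c x = greenCut ω c b x := by
  have h1 : b (‖x‖ ^ 2) = 1 := b.one_of_mem_closedBall (by
    rw [mem_closedBall_zero_iff, Real.norm_of_nonneg (sq_nonneg _)]; exact hx)
  rw [greenFn, greenCut, regGreen, h1, radialWave]
  simp only [ne_eq, OfNat.ofNat_ne_zero, not_false_eq_true, zero_pow, add_zero, norm_nonneg,
    Real.sqrt_sq, pow_one]
  push_cast
  rw [div_eq_mul_inv, mul_inv]
  ring

theorem integrable_greenCut : Integrable (greenCut ω c b) :=
  (integrable_regGreen (ω / c) b 0).const_mul _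

theorem hasCompactSupport_greenCut : HasCompactSupport (greenCut ω c b) :=
  (hasCompactSupport_regGreen (ω / c) b 0).mul_left

theorem contDiffAt_greenCut (x : E3) (hx : x ≠ 0) : ContDiffAt ℝ ((⊤ : ℕ∞) : WithTop ℕ∞) (greenCut ω c b) x :=
  contDiffAt_const.mul (contDiffAt_regGreen (ω / c) b
    (by have := norm_pos_iff.2 hx; positivity))

theorem fourier_greenCut (ξ : E3) :
    𝓕 (greenCut ω c b) ξ = (4 * Real.pi : ℂ)⁻¹ * 𝓕 (regGreen (ω / c) b 0) ξ := by
  simp only [Real.fourier_eq, greenCut, ← integral_const_mul, mul_smul_comm]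

theorem fourier_greenCut_neg (ξ : E3) : 𝓕 (greenCut ω c b) (-ξ) = 𝓕 (greenCut ω c b) ξ := by
  have h := Real.fourier_comp_linearIsometry (LinearIsometryEquiv.neg ℝ (E := E3))
    (greenCut ω c b) ξ
  have h2 : greenCut ω c b ∘ (LinearIsometryEquiv.neg ℝ (E := E3)) = greenCut ω c b := by
    ext x; simp [greenCut, regGreen]
  rw [h2] at h
  simpa using h.symm

/-- The symbol of the Green tensor. -/
noncomputable def greenSymbol (i j : Fin 3) (ξ : E3) : ℂ :=
  ((if i = j then 1 else 0) + ((c ^ 2 / ω ^ 2 : ℝ) : ℂ) *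
    ((2 * Real.pi * Complex.I) ^ 2 * (inner ℝ ξ (basisVec i) : ℝ) * (inner ℝ ξ (basisVec j) : ℝ)))
    * 𝓕 (greenCut ω c b) ξ

theorem greenSymbol_neg (i j : Fin 3) (ξ : E3) :
    greenSymbol ω c b i j (-ξ) = greenSymbol ω c b i j ξ := by
  simp only [greenSymbol, fourier_greenCut_neg, inner_neg_left]
  push_cast
  ring

/-- The diagonal part is bounded by the `L¹` norm of the kernel, the part with `ξᵢ ξⱼ` by the
quadratic decay of its transform. -/
theorem memLp_greenSymbol (i j : Fin 3) : MemLp (greenSymbol ω c b i j) ∞ := by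
  have hc : Continuous (𝓕 (greenCut ω c b)) := continuous_fourier (integrable_greenCut ω c b)
  obtain ⟨C, hC⟩ := exists_sq_norm_mul_fourier_regGreen_le (ω / c) b
  have hC' : ∀ ξ, ‖ξ‖ ^ 2 * ‖𝓕 (greenCut ω c b) ξ‖ ≤ (4 * Real.pi)⁻¹ * C := by
    intro ξ
    rw [fourier_greenCut, norm_mul]
    have : ‖(4 * Real.pi : ℂ)⁻¹‖ = (4 * Real.pi)⁻¹ := by simp [abs_of_pos Real.pi_pos]
    rw [this, mul_left_comm]
    exact mul_le_mul_of_nonneg_left (hC ξ) (by positivity)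
  have hB : ∀ ξ, ‖𝓕 (greenCut ω c b) ξ‖ ≤ ∫ x, ‖greenCut ω c b x‖ := fun ξ =>
    VectorFourier.norm_fourierIntegral_le_integral_norm _ _ _ _ _
  refine memLp_top_of_bound (by unfold greenSymbol; fun_prop)
    (1 * (∫ x, ‖greenCut ω c b x‖)
      + c ^ 2 / ω ^ 2 * ((2 * Real.pi) ^ 2 * ((4 * Real.pi)⁻¹ * C)))
    (Filter.Eventually.of_forall fun ξ => ?_)
  have hn : ‖(2 * Real.pi * Complex.I : ℂ)‖ = 2 * Real.pi := by
    simp [abs_of_pos Real.pi_pos]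
  have hin : ∀ i, |inner ℝ ξ (basisVec i)| ≤ ‖ξ‖ := fun i => by
    simpa [basisVec] using abs_real_inner_le_norm ξ (basisVec i)
  rw [greenSymbol, add_mul]
  refine (norm_add_le _ _).trans (add_le_add ?_ ?_)
  · rw [norm_mul]
    refine mul_le_mul ?_ (hB ξ) (norm_nonneg _) zero_le_one
    split_ifs <;> simp
  · rw [norm_mul, norm_mul, norm_mul, norm_mul, norm_pow, hn, Complex.norm_real,
      Complex.norm_real, Complex.norm_real, Real.norm_of_nonneg (by positivity), mul_assoc]
    refine mul_le_mul_of_nonneg_left ?_ (by positivity)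
    rw [mul_assoc, mul_assoc]
    refine mul_le_mul_of_nonneg_left ?_ (by positivity)
    refine le_trans ?_ (hC' ξ)
    rw [← mul_assoc, sq]
    refine mul_le_mul_of_nonneg_right ?_ (norm_nonneg _)
    exact mul_le_mul (hin i) (hin j) (abs_nonneg _) (norm_nonneg _)

/-- The Green tensor as a bounded operator on `L²`. -/
noncomputable def greenOp (i j : Fin 3) :
    Lp ℂ 2 (volume : Measure E3) →L[ℂ] Lp ℂ 2 (volume : Measure E3) :=
  fourierMultL2 ((memLp_greenSymbol ω c b i j).toLp _)

/-- The weak form of the multiplier: on the frequency side the polynomial factor of the symbol is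
assigned to `φ`, so that the potential need not be differentiated. -/
theorem integral_mul_greenOp (i j : Fin 3) {g : E3 → ℂ} (hg1 : Integrable g) (hg2 : MemLp g 2)
    (φ : 𝓢(E3, ℂ)) :
    ∫ x, φ x * greenOp ω c b i j (hg2.toLp g) x =
      (if i = j then 1 else 0) * (∫ x, φ x * potential (greenCut ω c b) g x)
      + ((c ^ 2 / ω ^ 2 : ℝ) : ℂ) *
        ∫ x, (∂_{basisVec j} (∂_{basisVec i} φ)) x * potential (greenCut ω c b) g x := by
  set w := potential (greenCut ω c b) g with hw
  have hwi : Integrable w := integrable_potential (integrable_greenCut ω c b) hg1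
  have key : ∀ ψ : 𝓢(E3, ℂ), ∫ x, ψ x * w x =
      ∫ ξ, 𝓕⁻ ψ ξ * (𝓕 (greenCut ω c b) ξ * 𝓕 g ξ) := by
    intro ψ
    have h := integral_fourier_mul_eq_flip (𝓕⁻ ψ).integrable hwi
    have h1 : 𝓕 ((𝓕⁻ ψ : 𝓢(E3, ℂ)) : E3 → ℂ) = ψ := by
      rw [← SchwartzMap.fourier_coe, FourierTransform.fourier_fourierInv_eq]
    rw [h1] at h
    rw [h]
    simp_rw [hw, fourier_potential (integrable_greenCut ω c b) hg1]
  have hφ2 : MemLp φ 2 := φ.memLp 2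
  have hL : ∫ x, φ x * greenOp ω c b i j (hg2.toLp g) x =
      ∫ ξ, 𝓕⁻ φ ξ * (greenSymbol ω c b i j ξ * 𝓕 g ξ) := by
    have h := pairL2_fourierMultL2 (memLp_greenSymbol ω c b i j) φ.integrable hφ2 hg1 hg2
    rw [pairL2_apply] at h
    have e : ∀ ξ, 𝓕⁻ φ ξ = 𝓕 (φ : E3 → ℂ) (-ξ) := fun ξ => by
      rw [SchwartzMap.fourierInv_coe, Real.fourierInv_eq_fourier_neg]
    simp_rw [e]
    rw [← h]
    refine integral_congr_ae ?_
    filter_upwards [hφ2.coeFn_toLp] with x hx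
    rw [hx]
    rfl
  have hint : ∀ ψ : 𝓢(E3, ℂ), Integrable
      (fun ξ => 𝓕⁻ ψ ξ * (𝓕 (greenCut ω c b) ξ * 𝓕 g ξ)) := by
    intro ψ
    refine (𝓕⁻ ψ).integrable.mul_bdd
      (c := (∫ x, ‖greenCut ω c b x‖) * ∫ x, ‖g x‖) ?_ (Filter.Eventually.of_forall fun ξ => ?_)
    · exact ((continuous_fourier (integrable_greenCut ω c b)).mul
        (continuous_fourier hg1)).aestronglyMeasurable
    · rw [norm_mul]
      exact mul_le_mul (VectorFourier.norm_fourierIntegral_le_integral_norm _ _ _ _ _)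
        (VectorFourier.norm_fourierIntegral_le_integral_norm _ _ _ _ _) (norm_nonneg _)
        (integral_nonneg fun _ => norm_nonneg _)
  rw [hL, key, key, ← integral_const_mul, ← integral_const_mul,
    ← integral_add ((hint _).const_mul _) ((hint _).const_mul _)]
  refine integral_congr_ae (Filter.Eventually.of_forall fun ξ => ?_)
  simp only [SchwartzMap.fourierInv_lineDeriv_lineDeriv, greenSymbol]
  ring

end Multiplier

/-! ### Plane waves. -/

section PlaneWave

theorem norm_planeWave (k x : E3) : ‖planeWave k x‖ = 1 := by
  rw [planeWave, mul_comm, Complex.norm_exp_ofReal_mul_I]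

theorem planeWave_add (k l x : E3) : planeWave (k + l) x = planeWave k x * planeWave l x := by
  rw [planeWave, planeWave, planeWave, ← Complex.exp_add, inner_add_left]
  push_cast
  ring_nf

@[simp]
theorem planeWave_zero (x : E3) : planeWave 0 x = 1 := by simp [planeWave]

theorem contDiff_planeWave (k : E3) {n : WithTop ℕ∞} : ContDiff ℝ n (planeWave k) := by
  have h : ContDiff ℝ n (fun x : E3 => ((inner ℝ k x : ℝ) : ℂ)) :=
    Complex.ofRealCLM.contDiff.comp (contDiff_const.inner ℝ contDiff_id)
  exact (contDiff_const.mul h).cexp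

theorem continuous_planeWave (k : E3) : Continuous (planeWave k) :=
  (contDiff_planeWave k (n := 0)).continuous

theorem norm_planeWave_sub_le (k l x : E3) :
    ‖planeWave k x - planeWave l x‖ ≤ ‖k - l‖ * ‖x‖ := by
  have h : planeWave k x - planeWave l x = planeWave l x * (planeWave (k - l) x - 1) := by
    rw [mul_sub, ← planeWave_add, add_sub_cancel, mul_one]
  rw [h, norm_mul, norm_planeWave, one_mul]
  exact (Real.norm_exp_I_mul_ofReal_sub_one_le).trans (norm_inner_le_norm _ _)

end PlaneWave

/-! ### The classical tensor potential agrees with the multiplier on `Ω`. -/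

section TensorPotential
open scoped SchwartzMap LineDeriv ContDiff

variable {Ω : Set E3} {g : E3 → ℂ}

theorem memLp_indicator_of_bound (hΩ : MeasurableSet Ω) (hΩb : Bornology.IsBounded Ω)
    (hg : Continuous g) (hgb : ∃ M, ∀ x, ‖g x‖ ≤ M) (p : ℝ≥0∞) :
    MemLp (Ω.indicator g) p := by
  obtain ⟨M, hM⟩ := hgb
  have : IsFiniteMeasure ((volume : Measure E3).restrict Ω) :=
    ⟨by simpa using hΩb.measure_lt_top⟩
  exact (memLp_indicator_iff_restrict hΩ).2
    (MemLp.of_bound hg.aestronglyMeasurable M (Filter.Eventually.of_forall hM))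

theorem volumePotential_eq_potential {freq c : ℝ} {b : ContDiffBump (0 : ℝ)}
    (hΩ : MeasurableSet Ω) (hb : ∀ y ∈ Ω, ∀ z ∈ Ω, ‖y - z‖ ^ 2 ≤ b.rIn) {y : E3} (hy : y ∈ Ω) :
    volumePotential Ω freq c g y = potential (greenCut freq c b) (Ω.indicator g) y := by
  rw [volumePotential, potential, ← integral_indicator hΩ]
  refine integral_congr_ae (Filter.Eventually.of_forall fun z => ?_)
  by_cases hz : z ∈ Ω
  · simp [hz, greenFn_eq_greenCut freq c b (hb y hy z hz)]
  · simp [hz]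

/-- Truncation does not change the potential on the open set `Ω`, hence not near any of its points,
so the derivatives agree as well. -/
theorem tensorPotential_eq {freq c : ℝ} {b : ContDiffBump (0 : ℝ)} (i j : Fin 3)
    (hΩ : IsOpen Ω) (hb : ∀ y ∈ Ω, ∀ z ∈ Ω, ‖y - z‖ ^ 2 ≤ b.rIn) {y : E3} (hy : y ∈ Ω) :
    tensorPotential Ω freq c i j g y =
      (if i = j then 1 else 0) * potential (greenCut freq c b) (Ω.indicator g) y
      + ((c ^ 2 / freq ^ 2 : ℝ) : ℂ) * fderiv ℝ (fun x => fderiv ℝ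
        (potential (greenCut freq c b) (Ω.indicator g)) x (basisVec j)) y (basisVec i) := by
  have h1 : ∀ x ∈ Ω, volumePotential Ω freq c g =ᶠ[nhds x]
      potential (greenCut freq c b) (Ω.indicator g) := fun x hx => by
    filter_upwards [hΩ.mem_nhds hx] with z hz
    exact volumePotential_eq_potential hΩ.measurableSet hb hz
  have h2 : partialD j (volumePotential Ω freq c g) =ᶠ[nhds y]
      fun x => fderiv ℝ (potential (greenCut freq c b) (Ω.indicator g)) x (basisVec j) := by
    filter_upwards [hΩ.mem_nhds hy] with z hz
    rw [partialD, (h1 z hz).fderiv_eq]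
  rw [tensorPotential, (h1 y hy).eq_of_nhds]
  congr 1
  · split_ifs <;> simp
  · rw [partialD, h2.fderiv_eq]

/-- The tensor potential of a smooth function is given by a bounded operator on `L²`. -/
theorem tensorPotential_ae_eq_greenOp {freq c : ℝ} {b : ContDiffBump (0 : ℝ)} (i j : Fin 3)
    (hΩ : IsOpen Ω) (hΩb : Bornology.IsBounded Ω)
    (hb : ∀ y ∈ Ω, ∀ z ∈ Ω, ‖y - z‖ ^ 2 ≤ b.rIn) (hg : ContDiff ℝ ∞ g)
    (hgb : ∃ M, ∀ x, ‖g x‖ ≤ M) :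
    ∀ᵐ y : E3, y ∈ Ω → greenOp freq c b i j
        ((memLp_indicator_of_bound hΩ.measurableSet hΩb hg.continuous hgb 2).toLp _) y =
      tensorPotential Ω freq c i j g y := by
  have hm1 : Integrable (Ω.indicator g) := memLp_one_iff_integrable.1
    (memLp_indicator_of_bound hΩ.measurableSet hΩb hg.continuous hgb 1)
  have hm2 := memLp_indicator_of_bound hΩ.measurableSet hΩb hg.continuous hgb 2
  set u := greenOp freq c b i j (hm2.toLp _) with hu
  set w := potential (greenCut freq c b) (Ω.indicator g) with hw
  have hws : ∀ x ∈ Ω, ContDiffAt ℝ ∞ w x := fun x hx =>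
    contDiffAt_potential hΩ hΩb (integrable_greenCut freq c b)
      (hasCompactSupport_greenCut freq c b) (contDiffAt_greenCut freq c b) hg hgb hx
  set D : E3 → ℂ := fun y => fderiv ℝ (fun x => fderiv ℝ w x (basisVec j)) y (basisVec i) with hD
  have hDs : ∀ x ∈ Ω, ContinuousAt D x := fun x hx =>
    ((((hws x hx).fderiv_right (m := ∞) (by simp)).clm_apply
      contDiffAt_const).fderiv_right (m := ∞) (by simp)).continuousAt.clm_apply continuousAt_const
  set F : E3 → ℂ := fun y =>
    (if i = j then 1 else 0) * w y + ((c ^ 2 / freq ^ 2 : ℝ) : ℂ) * D y with hF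
  have hFc : ∀ x ∈ Ω, ContinuousAt F x := fun x hx =>
    (continuousAt_const.mul (hws x hx).continuousAt).add (continuousAt_const.mul (hDs x hx))
  -- The `L²` function `u` and the classical expression `F` are compared weakly, with test functions
  -- supported in `Ω`, where `w` is smooth; two integrations by parts turn one weak form into the
  -- other.
  have hmain : ∀ᵐ y : E3, y ∈ Ω → u y - F y = 0 := by
    refine hΩ.ae_eq_zero_of_integral_contDiff_smul_eq_zero ?_ ?_
    · refine LocallyIntegrableOn.sub ?_ ?_
      · exact ((Lp.memLp u).locallyIntegrable (by norm_num)).locallyIntegrableOn Ω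
      · exact ContinuousOn.locallyIntegrableOn
          (fun x hx => (hFc x hx).continuousWithinAt) hΩ.measurableSet
    · intro f hf hfc hfΩ
      have hφc : HasCompactSupport (fun x => (f x : ℂ)) :=
        hfc.comp_left (g := ((↑) : ℝ → ℂ)) Complex.ofReal_zero
      have hφs : ContDiff ℝ ∞ (fun x => (f x : ℂ)) := Complex.ofRealCLM.contDiff.comp hf
      let φ : 𝓢(E3, ℂ) := hφc.toSchwartzMap hφs
      have hφ : ∀ x, φ x = (f x : ℂ) := fun x => rfl
      have hφΩ : tsupport (fun x => (f x : ℂ)) ⊆ Ω :=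
        (closure_mono (Function.support_comp_subset Complex.ofReal_zero f)).trans hfΩ
      have hi1 : Integrable (fun x => φ x * u x) :=
        (φ.memLp 2).integrable_mul (Lp.memLp u)
      have hi2 : Integrable (fun x => φ x * w x) :=
        integrable_mul_of_tsupport_subset hφs.continuous hφc hφΩ
          fun x hx => (hws x hx).continuousAt
      have hi3 : Integrable (fun x => φ x * D x) :=
        integrable_mul_of_tsupport_subset hφs.continuous hφc hφΩ hDs
      have hibp : ∫ x, φ x * D x =
          ∫ x, (∂_{basisVec j} (∂_{basisVec i} φ)) x * w x :=
        integral_mul_fderiv_fderiv (basisVec i) (basisVec j) hφs hφc hφΩ hws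
      have hL := integral_mul_greenOp freq c b i j hm1 hm2 φ
      simp only [Complex.real_smul, ← hφ]
      have e : ∀ x, φ x * (u x - F x) = φ x * u x - ((if i = j then 1 else 0) * (φ x * w x)
          + ((c ^ 2 / freq ^ 2 : ℝ) : ℂ) * (φ x * D x)) := fun x => by
        simp only [hF]; ring
      have hi4 : Integrable (fun x => (if i = j then 1 else 0) * (φ x * w x)
          + ((c ^ 2 / freq ^ 2 : ℝ) : ℂ) * (φ x * D x)) :=
        (hi2.const_mul _).add (hi3.const_mul _)
      simp_rw [e]
      rw [integral_sub hi1 hi4,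
        integral_add (hi2.const_mul _) (hi3.const_mul _), integral_const_mul, integral_const_mul,
        hibp, hL, sub_self]
  filter_upwards [hmain] with y hy hyΩ
  rw [tensorPotential_eq i j hΩ hb hyΩ]
  exact sub_eq_zero.1 (hy hyΩ)

end TensorPotential

/-! ### The integral kernels as Fourier integrals over `Ω`. -/

section Kernels
open scoped FourierTransform

variable {Ω : Set E3}

theorem memLp_indicator_planeWave (hΩ : IsOpen Ω) (hΩb : Bornology.IsBounded Ω) (p : ℝ≥0∞)
    (k : E3) : MemLp (Ω.indicator (planeWave k)) p :=
  memLp_indicator_of_bound hΩ.measurableSet hΩb (continuous_planeWave k)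
    ⟨1, fun x => (norm_planeWave k x).le⟩ p

/-- The plane wave on `Ω`, extended by zero, as an element of `Lᵖ`. -/
noncomputable def waveLp (hΩ : IsOpen Ω) (hΩb : Bornology.IsBounded Ω) (p : ℝ≥0∞) (k : E3) :
    Lp ℂ p (volume : Measure E3) :=
  (memLp_indicator_planeWave hΩ hΩb p k).toLp _

theorem waveLp_coeFn (hΩ : IsOpen Ω) (hΩb : Bornology.IsBounded Ω) (p : ℝ≥0∞) (k : E3) :
    waveLp hΩ hΩb p k =ᵐ[volume] Ω.indicator (planeWave k) :=
  MemLp.coeFn_toLp _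

theorem continuous_waveLp_top (hΩ : IsOpen Ω) (hΩb : Bornology.IsBounded Ω) :
    Continuous (waveLp hΩ hΩb ∞) := by
  obtain ⟨R, hR0, hR⟩ : ∃ R, 0 ≤ R ∧ ∀ x ∈ Ω, ‖x‖ ≤ R := by
    obtain ⟨R, hR⟩ := hΩb.exists_norm_le
    exact ⟨max R 0, le_max_right _ _, fun x hx => (hR x hx).trans (le_max_left _ _)⟩
  -- The Lipschitz constant is a bound `R` for `Ω`, since `k ↦ exp (i ⟨k, x⟩)` is Lipschitz with
  -- constant `|x|`.
  refine LipschitzWith.continuous (K := R.toNNReal) (LipschitzWith.of_dist_le_mul fun k l => ?_)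
  rw [dist_eq_norm, dist_eq_norm, waveLp, waveLp, ← MemLp.toLp_sub, Lp.norm_toLp,
    eLpNorm_exponent_top, Real.coe_toNNReal R hR0]
  refine ENNReal.toReal_le_of_le_ofReal (by positivity) ?_
  refine eLpNormEssSup_le_of_ae_bound (Filter.Eventually.of_forall fun x => ?_)
  by_cases hx : x ∈ Ω
  · simp only [Pi.sub_apply, Set.indicator_of_mem hx]
    refine (norm_planeWave_sub_le k l x).trans ?_
    rw [mul_comm]
    gcongr
    exact hR x hx
  · simp only [Pi.sub_apply, Set.indicator_of_notMem hx, sub_zero, norm_zero]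
    positivity

/-- The wave with frequency `0` is the indicator of `Ω`; this factorisation carries continuity in
`k` from `L^∞` over to `L²`. -/
theorem waveLp_two_eq (hΩ : IsOpen Ω) (hΩb : Bornology.IsBounded Ω) (k : E3) :
    waveLp hΩ hΩb 2 k = (ContinuousLinearMap.mul ℂ ℂ).holderL volume ∞ 2 2
      (waveLp hΩ hΩb ∞ k) (waveLp hΩ hΩb 2 0) := by
  refine Lp.ext ?_
  rw [ContinuousLinearMap.holderL_apply_apply]
  filter_upwards [waveLp_coeFn hΩ hΩb 2 k, waveLp_coeFn hΩ hΩb ∞ k, waveLp_coeFn hΩ hΩb 2 0,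
    ContinuousLinearMap.coeFn_holder (r := 2) (ContinuousLinearMap.mul ℂ ℂ)
      (waveLp hΩ hΩb ∞ k) (waveLp hΩ hΩb 2 0)] with x h1 h2 h3 h4
  rw [h4, h1, h2, h3]
  by_cases hx : x ∈ Ω <;> simp [hx]

theorem continuous_waveLp_two (hΩ : IsOpen Ω) (hΩb : Bornology.IsBounded Ω) :
    Continuous (waveLp hΩ hΩb 2) := by
  rw [funext (waveLp_two_eq hΩ hΩb)]
  exact (((ContinuousLinearMap.mul ℂ ℂ).holderL volume ∞ 2 2).continuous.comp
    (continuous_waveLp_top hΩ hΩb)).clm_apply continuous_const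

variable (freq c : ℝ) (b : ContDiffBump (0 : ℝ))

/-- The density `exp (i ⟨l, x⟩) 𝒯[exp (i ⟨m, ·⟩)](x)` on `Ω`, where `𝒯` is an entry of the Green
tensor. -/
noncomputable def kernelDensity (hΩ : IsOpen Ω) (hΩb : Bornology.IsBounded Ω) (i j : Fin 3)
    (l m : E3) : Lp ℂ 2 ((volume : Measure E3).restrict Ω) :=
  LpToLpRestrictCLM E3 ℂ ℂ volume 2 Ω
    ((ContinuousLinearMap.mul ℂ ℂ).holderL volume ∞ 2 2 (waveLp hΩ hΩb ∞ l)
      (greenOp freq c b i j (waveLp hΩ hΩb 2 m)))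

theorem continuous_kernelDensity (hΩ : IsOpen Ω) (hΩb : Bornology.IsBounded Ω) (i j : Fin 3)
    {X : Type*} [TopologicalSpace X] {l m : X → E3} (hl : Continuous l) (hm : Continuous m) :
    Continuous fun θ => kernelDensity freq c b hΩ hΩb i j (l θ) (m θ) := by
  refine (LpToLpRestrictCLM E3 ℂ ℂ volume 2 Ω).continuous.comp ?_
  refine Continuous.clm_apply ?_ ?_
  · exact ((ContinuousLinearMap.mul ℂ ℂ).holderL volume ∞ 2 2).continuous.comp
      ((continuous_waveLp_top hΩ hΩb).comp hl)
  · exact (greenOp freq c b i j).continuous.comp ((continuous_waveLp_two hΩ hΩb).comp hm)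

theorem kernelDensity_coeFn (hΩ : IsOpen Ω) (hΩb : Bornology.IsBounded Ω) (i j : Fin 3)
    (l m : E3) : kernelDensity freq c b hΩ hΩb i j l m =ᵐ[volume.restrict Ω]
      fun x => planeWave l x * greenOp freq c b i j (waveLp hΩ hΩb 2 m) x := by
  refine (LpToLpRestrictCLM_coeFn ℂ Ω _).trans ?_
  rw [ContinuousLinearMap.holderL_apply_apply]
  filter_upwards [ae_restrict_mem hΩ.measurableSet, ae_restrict_of_ae (waveLp_coeFn hΩ hΩb ∞ l),
    ae_restrict_of_ae (ContinuousLinearMap.coeFn_holder (r := 2) (ContinuousLinearMap.mul ℂ ℂ)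
      (waveLp hΩ hΩb ∞ l) (greenOp freq c b i j (waveLp hΩ hΩb 2 m)))] with x hx h1 h2
  rw [h2, h1, Set.indicator_of_mem hx]
  rfl

theorem pairL2_waveLp (hΩ : IsOpen Ω) (hΩb : Bornology.IsBounded Ω) (k : E3)
    (u : Lp ℂ 2 (volume : Measure E3)) :
    pairL2 volume (waveLp hΩ hΩb 2 k) u = ∫ x in Ω, planeWave k x * u x := by
  rw [pairL2_apply, ← integral_indicator hΩ.measurableSet]
  refine integral_congr_ae ?_
  filter_upwards [waveLp_coeFn hΩ hΩb 2 k] with x hx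
  rw [hx]
  by_cases h : x ∈ Ω <;> simp [h]

theorem pairL2_waveLp_greenOp_comm (hΩ : IsOpen Ω) (hΩb : Bornology.IsBounded Ω) (i j : Fin 3)
    (k l : E3) :
    pairL2 volume (waveLp hΩ hΩb 2 k) (greenOp freq c b i j (waveLp hΩ hΩb 2 l)) =
      pairL2 volume (waveLp hΩ hΩb 2 l) (greenOp freq c b i j (waveLp hΩ hΩb 2 k)) :=
  pairL2_fourierMultL2_comm (memLp_greenSymbol freq c b i j) (greenSymbol_neg freq c b i j)
    (memLp_one_iff_integrable.1 (memLp_indicator_planeWave hΩ hΩb 1 k)) _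
    (memLp_one_iff_integrable.1 (memLp_indicator_planeWave hΩ hΩb 1 l)) _

theorem pairL2_waveLp_add (hΩ : IsOpen Ω) (hΩb : Bornology.IsBounded Ω) (i j : Fin 3)
    (k l m : E3) :
    pairL2 volume (waveLp hΩ hΩb 2 (l + k)) (greenOp freq c b i j (waveLp hΩ hΩb 2 m)) =
      ∫ x in Ω, planeWave k x * kernelDensity freq c b hΩ hΩb i j l m x := by
  rw [pairL2_waveLp]
  refine integral_congr_ae ?_
  filter_upwards [kernelDensity_coeFn freq c b hΩ hΩb i j l m] with x hx
  rw [hx, planeWave_add]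
  ring

variable {freq c b}

theorem integral_planeWave_mul_tensorPotential (hΩ : IsOpen Ω) (hΩb : Bornology.IsBounded Ω)
    (hb : ∀ y ∈ Ω, ∀ z ∈ Ω, ‖y - z‖ ^ 2 ≤ b.rIn) (i j : Fin 3) (k m : E3) :
    ∫ y in Ω, planeWave k y * tensorPotential Ω freq c i j (planeWave m) y =
      pairL2 volume (waveLp hΩ hΩb 2 k) (greenOp freq c b i j (waveLp hΩ hΩb 2 m)) := by
  rw [pairL2_waveLp]
  refine setIntegral_congr_ae hΩ.measurableSet ?_
  filter_upwards [tensorPotential_ae_eq_greenOp (freq := freq) (c := c) i j hΩ hΩb hb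
    (contDiff_planeWave m) ⟨1, fun x => (norm_planeWave m x).le⟩] with x hx hxΩ
  rw [← hx hxΩ]
  rfl

/-- The wave with frequency `k` sits inside the Green tensor; symmetry of the multiplier exchanges
it with the outer wave, after which `k` occurs only in a Fourier integral. -/
theorem kernelZ_eq (hΩ : IsOpen Ω) (hΩb : Bornology.IsBounded Ω)
    (hb : ∀ y ∈ Ω, ∀ z ∈ Ω, ‖y - z‖ ^ 2 ≤ b.rIn) (i j : Fin 3) (θ k : E3) :
    kernelZ Ω freq c θ k i j = ((freq ^ 2 / (c ^ 2 * (2 * Real.pi) ^ 3) : ℝ) : ℂ) *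
      ∫ x in Ω, planeWave k x * kernelDensity freq c b hΩ hΩb i j
        (-((freq / c) • basisVec 2)) (-((freq / c) • θ)) x := by
  have h : (fun z => planeWave (-((freq / c) • basisVec 2)) z * planeWave k z) =
      planeWave (-((freq / c) • basisVec 2) + k) := funext fun z => (planeWave_add _ _ _).symm
  rw [kernelZ, h, integral_planeWave_mul_tensorPotential hΩ hΩb hb,
    pairL2_waveLp_greenOp_comm, pairL2_waveLp_add]

/-- Here the wave with frequency `k` already stands outside the tensor, so no symmetry is needed. -/
theorem kernelY_eq (hΩ : IsOpen Ω) (hΩb : Bornology.IsBounded Ω)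
    (hb : ∀ y ∈ Ω, ∀ z ∈ Ω, ‖y - z‖ ^ 2 ≤ b.rIn) (i j : Fin 3) (θ k : E3) :
    kernelY Ω freq c θ k i j = ((freq ^ 2 / (c ^ 2 * (2 * Real.pi) ^ 3) : ℝ) : ℂ) *
      ∫ x in Ω, planeWave k x * kernelDensity freq c b hΩ hΩb i j
        (-((freq / c) • θ)) (-((freq / c) • basisVec 2)) x := by
  simp_rw [kernelY, ← planeWave_add]
  rw [integral_planeWave_mul_tensorPotential hΩ hΩb hb, pairL2_waveLp_add]

theorem integral_planeWave_mul_eq_fourier (hΩ : IsOpen Ω) (h : E3 → ℂ) (k : E3) :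
    ∫ x in Ω, planeWave k x * h x = 𝓕 (Ω.indicator h) (-((2 * Real.pi)⁻¹ • k)) := by
  rw [Real.fourier_eq, ← integral_indicator hΩ.measurableSet]
  refine integral_congr_ae (Filter.Eventually.of_forall fun x => ?_)
  by_cases hx : x ∈ Ω
  · simp only [Set.indicator_of_mem hx, Circle.smul_def, Real.fourierChar_apply, smul_eq_mul,
      planeWave, inner_neg_right, inner_smul_right, neg_neg, real_inner_comm k x]
    congr 2
    have : (Real.pi : ℂ) ≠ 0 := by exact_mod_cast Real.pi_ne_zero
    push_cast
    field_simp
  · simp [hx]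

theorem fourierOn_eq_fourier (hΩ : IsOpen Ω) (f : E3 → ℂ) (k : E3) :
    fourierOn Ω f k = 𝓕 (Ω.indicator f) ((2 * Real.pi)⁻¹ • k) := by
  have h := integral_planeWave_mul_eq_fourier hΩ f (-k)
  rw [smul_neg, neg_neg] at h
  rw [fourierOn, ← h]
  simp_rw [mul_comm]

theorem memLp_indicator_Lp (hΩ : IsOpen Ω) (f : Lp ℂ 2 ((volume : Measure E3).restrict Ω)) :
    MemLp (Ω.indicator f) 2 :=
  (memLp_indicator_iff_restrict hΩ.measurableSet).2 (Lp.memLp f)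

theorem integrable_indicator_Lp (hΩ : IsOpen Ω) (hΩb : Bornology.IsBounded Ω)
    (f : Lp ℂ 2 ((volume : Measure E3).restrict Ω)) : Integrable (Ω.indicator f) := by
  have : IsFiniteMeasure ((volume : Measure E3).restrict Ω) :=
    ⟨by simpa using hΩb.measure_lt_top⟩
  exact (integrable_indicator_iff hΩ.measurableSet).2 ((Lp.memLp f).integrable (by norm_num))

theorem integrable_planeWave_mul_fourierOn (hΩ : IsOpen Ω) (hΩb : Bornology.IsBounded Ω)
    (h f : Lp ℂ 2 ((volume : Measure E3).restrict Ω)) :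
    Integrable (fun k => (∫ x in Ω, planeWave k x * h x) * fourierOn Ω f k) := by
  simp_rw [integral_planeWave_mul_eq_fourier hΩ, fourierOn_eq_fourier hΩ]
  have h1 := memLp_fourier (integrable_indicator_Lp hΩ hΩb h) (memLp_indicator_Lp hΩ h)
  have h2 := memLp_fourier (integrable_indicator_Lp hΩ hΩb f) (memLp_indicator_Lp hΩ f)
  have h3 : MemLp (fun ξ => 𝓕 (Ω.indicator h) (-ξ)) 2 :=
    h1.comp_measurePreserving (Measure.measurePreserving_neg volume)
  exact (h3.integrable_mul h2).comp_smul (R := (2 * Real.pi)⁻¹)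
    (by have := Real.pi_pos; positivity)

/-- Parseval's formula; the rescaling of `k` by `2π` in three dimensions produces the factor that
cancels the `(2π)⁻³` of the kernels. -/
theorem integral_planeWave_mul_fourierOn (hΩ : IsOpen Ω) (hΩb : Bornology.IsBounded Ω)
    (h f : Lp ℂ 2 ((volume : Measure E3).restrict Ω)) :
    ∫ k, (∫ x in Ω, planeWave k x * h x) * fourierOn Ω f k =
      (((2 * Real.pi) ^ 3 : ℝ) : ℂ) * pairL2 (volume.restrict Ω) h f := by
  have hp := Real.pi_pos
  simp_rw [integral_planeWave_mul_eq_fourier hΩ, fourierOn_eq_fourier hΩ]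
  rw [Measure.integral_comp_smul_of_nonneg volume
    (fun ξ : E3 => 𝓕 (Ω.indicator h) (-ξ) * 𝓕 (Ω.indicator f) ξ) _ (hR := by positivity),
    integral_fourier_neg_mul_fourier (integrable_indicator_Lp hΩ hΩb h) (memLp_indicator_Lp hΩ h)
      (integrable_indicator_Lp hΩ hΩb f) (memLp_indicator_Lp hΩ f), pairL2_apply,
    ← integral_indicator hΩ.measurableSet]
  simp only [finrank_euclideanSpace, Fintype.card_fin, Complex.real_smul, inv_pow, inv_inv]
  congr 1
  refine integral_congr_ae (Filter.Eventually.of_forall fun x => ?_)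
  by_cases hx : x ∈ Ω <;> simp [hx]

theorem exists_bump_of_isBounded (hΩb : Bornology.IsBounded Ω) :
    ∃ b : ContDiffBump (0 : ℝ), ∀ y ∈ Ω, ∀ z ∈ Ω, ‖y - z‖ ^ 2 ≤ b.rIn := by
  obtain ⟨C, hC⟩ := Metric.isBounded_iff.1 hΩb
  -- The bump acts on the squared distance, so its inner radius must exceed the square of the bound
  -- `C` on distances in `Ω`; adding `1` keeps it positive.
  refine ⟨⟨C ^ 2 + 1, C ^ 2 + 2, by positivity, by linarith⟩, fun y hy z hz => ?_⟩
  have := hC hy hz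
  rw [dist_eq_norm] at this
  change _ ≤ C ^ 2 + 1
  nlinarith [norm_nonneg (y - z)]

end Kernels

/-! ### The operators as continuous families of functionals on the sphere. -/

section Families

variable {Ω : Set E3} {freq c : ℝ} {H : Type*} [NormedAddCommGroup H] [NormedSpace ℂ H]

/-- A linear functional of `ψ` that depends norm continuously on the direction. -/
def IsContinuousFamily (Φ : H → S2 → ℂ) : Prop :=
  ∃ A : C(S2, H →L[ℂ] ℂ), ∀ ψ θ, Φ ψ θ = A θ ψ

theorem IsContinuousFamily.add {Φ Ψ : H → S2 → ℂ} (hΦ : IsContinuousFamily Φ)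
    (hΨ : IsContinuousFamily Ψ) : IsContinuousFamily fun ψ θ => Φ ψ θ + Ψ ψ θ := by
  obtain ⟨A, hA⟩ := hΦ
  obtain ⟨B, hB⟩ := hΨ
  exact ⟨A + B, fun ψ θ => by simp [hA, hB]⟩

theorem IsContinuousFamily.mul_left {Φ : H → S2 → ℂ} (hΦ : IsContinuousFamily Φ) {a : S2 → ℂ}
    (ha : Continuous a) : IsContinuousFamily fun ψ θ => a θ * Φ ψ θ := by
  obtain ⟨A, hA⟩ := hΦ
  exact ⟨⟨fun θ => a θ • A θ, ha.smul A.continuous⟩, fun ψ θ => by simp [hA]⟩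

theorem IsContinuousFamily.sub {Φ Ψ : H → S2 → ℂ} (hΦ : IsContinuousFamily Φ)
    (hΨ : IsContinuousFamily Ψ) : IsContinuousFamily fun ψ θ => Φ ψ θ - Ψ ψ θ := by
  obtain ⟨A, hA⟩ := hΦ
  obtain ⟨B, hB⟩ := hΨ
  exact ⟨A - B, fun ψ θ => by simp [hA, hB]⟩

/-- The pairing is a bounded bilinear map, so `L²` continuity of `h` is norm continuity of the
functionals. -/
theorem isContinuousFamily_pairL2 (L : H →L[ℂ] Lp ℂ 2 ((volume : Measure E3).restrict Ω))
    {h : S2 → Lp ℂ 2 ((volume : Measure E3).restrict Ω)} (hh : Continuous h) :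
    IsContinuousFamily fun ψ θ => pairL2 (volume.restrict Ω) (h θ) (L ψ) :=
  ⟨⟨fun θ => (pairL2 (volume.restrict Ω) (h θ)).comp L,
    ((pairL2 (volume.restrict Ω)).continuous.comp hh).clm_comp continuous_const⟩,
    fun _ _ => rfl⟩

theorem kernel_const_mul (x : ℂ) :
    ((freq ^ 2 / (c ^ 2 * (2 * Real.pi) ^ 3) : ℝ) : ℂ) * ((((2 * Real.pi) ^ 3 : ℝ) : ℂ) * x) =
      ((freq ^ 2 / c ^ 2 : ℝ) : ℂ) * x := by
  rw [← mul_assoc, ← Complex.ofReal_mul]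
  congr 2
  have := Real.pi_ne_zero
  field_simp

theorem scalK_eq {b : ContDiffBump (0 : ℝ)} (hΩ : IsOpen Ω) (hΩb : Bornology.IsBounded Ω)
    (hb : ∀ y ∈ Ω, ∀ z ∈ Ω, ‖y - z‖ ^ 2 ≤ b.rIn) (i j : Fin 3)
    (f : Lp ℂ 2 ((volume : Measure E3).restrict Ω)) (θ : E3) :
    scalK Ω freq c i j (fourierOn Ω f) θ = ((freq ^ 2 / c ^ 2 : ℝ) : ℂ) *
      pairL2 (volume.restrict Ω) (kernelDensity freq c b hΩ hΩb i j
        (-((freq / c) • basisVec 2)) (-((freq / c) • θ))) f := by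
  rw [scalK]
  simp_rw [kernelZ_eq hΩ hΩb hb, mul_assoc]
  rw [integral_const_mul, integral_planeWave_mul_fourierOn hΩ hΩb, kernel_const_mul]

theorem scalKdag_eq {b : ContDiffBump (0 : ℝ)} (hΩ : IsOpen Ω) (hΩb : Bornology.IsBounded Ω)
    (hb : ∀ y ∈ Ω, ∀ z ∈ Ω, ‖y - z‖ ^ 2 ≤ b.rIn) (i j : Fin 3)
    (f : Lp ℂ 2 ((volume : Measure E3).restrict Ω)) (θ : E3) :
    scalKdag Ω freq c i j (fourierOn Ω f) θ = ((freq ^ 2 / c ^ 2 : ℝ) : ℂ) *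
      pairL2 (volume.restrict Ω) (kernelDensity freq c b hΩ hΩb i j
        (-((freq / c) • θ)) (-((freq / c) • basisVec 2))) f := by
  rw [scalKdag]
  simp_rw [kernelY_eq hΩ hΩb hb, mul_assoc]
  rw [integral_const_mul, integral_planeWave_mul_fourierOn hΩ hΩb, kernel_const_mul]

/-- Needed to split the integral of a matrix product into scalar operators. Both factors are square
integrable in `k`, being Fourier transforms of `L²` functions on `Ω`. -/
theorem integrable_kernelZ_mul (hΩ : IsOpen Ω) (hΩb : Bornology.IsBounded Ω) (i j : Fin 3)
    (f : Lp ℂ 2 ((volume : Measure E3).restrict Ω)) (θ : E3) :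
    Integrable fun k => kernelZ Ω freq c θ k i j * fourierOn Ω f k := by
  obtain ⟨b, hb⟩ := exists_bump_of_isBounded hΩb
  simp_rw [kernelZ_eq hΩ hΩb hb, mul_assoc]
  exact (integrable_planeWave_mul_fourierOn hΩ hΩb _ f).const_mul _

theorem integrable_kernelY_mul (hΩ : IsOpen Ω) (hΩb : Bornology.IsBounded Ω) (i j : Fin 3)
    (f : Lp ℂ 2 ((volume : Measure E3).restrict Ω)) (θ : E3) :
    Integrable fun k => kernelY Ω freq c θ k i j * fourierOn Ω f k := by
  obtain ⟨b, hb⟩ := exists_bump_of_isBounded hΩb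
  simp_rw [kernelY_eq hΩ hΩb hb, mul_assoc]
  exact (integrable_planeWave_mul_fourierOn hΩ hΩb _ f).const_mul _

theorem isContinuousFamily_scalK (hΩ : IsOpen Ω) (hΩb : Bornology.IsBounded Ω) (i j : Fin 3)
    (L : H →L[ℂ] Lp ℂ 2 ((volume : Measure E3).restrict Ω)) :
    IsContinuousFamily fun ψ (θ : S2) => scalK Ω freq c i j (fourierOn Ω (L ψ)) θ := by
  obtain ⟨b, hb⟩ := exists_bump_of_isBounded hΩb
  simp_rw [scalK_eq hΩ hΩb hb]
  exact (isContinuousFamily_pairL2 L (continuous_kernelDensity freq c b hΩ hΩb i j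
    continuous_const (by fun_prop))).mul_left continuous_const

theorem isContinuousFamily_scalKdag (hΩ : IsOpen Ω) (hΩb : Bornology.IsBounded Ω) (i j : Fin 3)
    (L : H →L[ℂ] Lp ℂ 2 ((volume : Measure E3).restrict Ω)) :
    IsContinuousFamily fun ψ (θ : S2) => scalKdag Ω freq c i j (fourierOn Ω (L ψ)) θ := by
  obtain ⟨b, hb⟩ := exists_bump_of_isBounded hΩb
  simp_rw [scalKdag_eq hΩ hΩb hb]
  exact (isContinuousFamily_pairL2 L (continuous_kernelDensity freq c b hΩ hΩb i j
    (by fun_prop) continuous_const)).mul_left continuous_const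

theorem continuous_coord (i : Fin 3) : Continuous fun θ : S2 => ((θ.1 i : ℝ) : ℂ) := by
  fun_prop

theorem continuous_proj (i j : Fin 3) : Continuous fun θ : S2 => proj θ.1 i j := by
  unfold proj
  fun_prop

theorem isContinuousFamily_opL (hΩ : IsOpen Ω) (hΩb : Bornology.IsBounded Ω) (k j : Fin 3)
    (L : H →L[ℂ] Lp ℂ 2 ((volume : Measure E3).restrict Ω)) :
    IsContinuousFamily fun ψ (θ : S2) => opL Ω freq c k j (fourierOn Ω (L ψ)) θ :=
  (((isContinuousFamily_scalK hΩ hΩb 0 j L).add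
    (isContinuousFamily_scalK hΩ hΩb 1 j L)).mul_left
      ((continuous_proj k 0).add (continuous_proj k 1))).add
    ((isContinuousFamily_scalK hΩ hΩb 2 j L).mul_left (continuous_proj k 2))

theorem isContinuousFamily_opM (hΩ : IsOpen Ω) (hΩb : Bornology.IsBounded Ω) (j : Fin 3)
    (L : H →L[ℂ] Lp ℂ 2 ((volume : Measure E3).restrict Ω)) :
    IsContinuousFamily fun ψ (θ : S2) => opM Ω freq c j (fourierOn Ω (L ψ)) θ :=
  (isContinuousFamily_scalKdag hΩ hΩb j 0 L).add (isContinuousFamily_scalKdag hΩ hΩb j 1 L)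

theorem isContinuousFamily_rowL (hΩ : IsOpen Ω) (hΩb : Bornology.IsBounded Ω)
    (p : Fin 3 → ℂ) (k : Fin 3) :
    IsContinuousFamily fun (ψ : Fin 3 → Lp ℂ 2 ((volume : Measure E3).restrict Ω)) (θ : S2) =>
      rowL Ω freq c p (fun l => fourierOn Ω (ψ l)) θ k := by
  have h : ∀ j l : Fin 3, IsContinuousFamily
      fun (ψ : Fin 3 → Lp ℂ 2 ((volume : Measure E3).restrict Ω)) (θ : S2) =>
        opL Ω freq c k j (fourierOn Ω (ψ l)) θ := fun j l => by
    have h := isContinuousFamily_opL (freq := freq) (c := c) hΩ hΩb k j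
      (ContinuousLinearMap.proj (R := ℂ)
        (φ := fun _ : Fin 3 => Lp ℂ 2 ((volume : Measure E3).restrict Ω)) l)
    simpa only [ContinuousLinearMap.proj_apply] using h
  exact (((h 0 0).mul_left continuous_const).add
    (((h 1 1).mul_left continuous_const).add ((h 0 1).mul_left continuous_const))).add
    ((h 1 2).mul_left continuous_const)

theorem isContinuousFamily_rowM (hΩ : IsOpen Ω) (hΩb : Bornology.IsBounded Ω) (k : Fin 3) :
    IsContinuousFamily fun (ψ : Fin 3 → Lp ℂ 2 ((volume : Measure E3).restrict Ω)) (θ : S2) =>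
      rowM Ω freq c (fun l => fourierOn Ω (ψ l)) θ k := by
  have h : ∀ j l : Fin 3, IsContinuousFamily
      fun (ψ : Fin 3 → Lp ℂ 2 ((volume : Measure E3).restrict Ω)) (θ : S2) =>
        opM Ω freq c j (fourierOn Ω (ψ l)) θ := fun j l => by
    have h := isContinuousFamily_opM (freq := freq) (c := c) hΩ hΩb j
      (ContinuousLinearMap.proj (R := ℂ)
        (φ := fun _ : Fin 3 => Lp ℂ 2 ((volume : Measure E3).restrict Ω)) l)
    simpa only [ContinuousLinearMap.proj_apply] using h
  exact (((h 0 0).mul_left (continuous_proj k 0)).add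
    (((h 0 1).mul_left (continuous_proj k 1)).add ((h 1 1).mul_left (continuous_proj k 0)))).add
    ((h 1 2).mul_left (continuous_proj k 1))

theorem isContinuousFamily_opN (hΩ : IsOpen Ω) (hΩb : Bornology.IsBounded Ω) (χ₀ : ℝ)
    (l : Fin 3) :
    IsContinuousFamily fun (ψ : Fin 3 → Lp ℂ 2 ((volume : Measure E3).restrict Ω)) (θ : S2) =>
      opN Ω freq c χ₀ (fun l => fourierOn Ω (ψ l)) θ l := by
  have hL := fun p k => isContinuousFamily_rowL (freq := freq) (c := c) hΩ hΩb p k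
  have hM := fun k => isContinuousFamily_rowM (freq := freq) (c := c) hΩ hΩb k
  fin_cases l
  · exact (hL (pol1 - pol2) 0).mul_left (a := fun _ => (χ₀ : ℂ)) continuous_const
  · exact (hL (pol1 - pol2) 1).mul_left (a := fun _ => (χ₀ : ℂ)) continuous_const
  · exact ((((hL pol1 0).add (hM 0)).mul_left (continuous_coord 1)).sub
      (((hL pol1 1).add (hM 1)).mul_left (continuous_coord 0))).mul_left
        (a := fun _ => (χ₀ : ℂ)) continuous_const

theorem continuous_matI : Continuous fun θ : S2 => matI θ.1 := by
  refine continuous_matrix fun i j => ?_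
  have h := continuous_proj
  have h' := continuous_coord
  fin_cases i <;> fin_cases j <;> simp [matI, rowI] <;> fun_prop

/-- The adjugate, unlike the inverse, is continuous on the whole sphere, including directions where
the determinant vanishes. -/
theorem isContinuousFamily_adjugate_mulVec (hΩ : IsOpen Ω) (hΩb : Bornology.IsBounded Ω)
    (χ₀ : ℝ) (i : Fin 3) :
    IsContinuousFamily fun (ψ : Fin 3 → Lp ℂ 2 ((volume : Measure E3).restrict Ω)) (θ : S2) =>
      ((matI θ).adjugate *ᵥ opN Ω freq c χ₀ (fun l => fourierOn Ω (ψ l)) θ) i := by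
  have h := fun l => (isContinuousFamily_opN (freq := freq) (c := c) hΩ hΩb χ₀ l).mul_left
    (continuous_matI.matrix_adjugate.matrix_elem i l)
  simp only [Matrix.mulVec, dotProduct, Fin.sum_univ_three]
  exact ((h 0).add (h 1)).add (h 2)

/-- No invertibility is needed: for determinant `0` both sides are `0` by the conventions for
inverses. -/
theorem opC_eq (χ₀ : ℝ) (y : Fin 3 → E3 → ℂ) (θ : E3) (i : Fin 3) :
    opC Ω freq c χ₀ y θ i =
      (matI θ).det⁻¹ * ((matI θ).adjugate *ᵥ opN Ω freq c χ₀ y θ) i := by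
  rw [opC, Matrix.inv_def, Ring.inverse_eq_inv', Matrix.smul_mulVec, Pi.smul_apply, smul_eq_mul]

instance isFiniteMeasure_surfaceMeasure : IsFiniteMeasure surfaceMeasure := by
  unfold surfaceMeasure
  infer_instance

theorem measurableSet_starDirections : MeasurableSet starDirections := by
  have h : ∀ i : Fin 3, Continuous fun θ : S2 => θ.1 i := fun i => by fun_prop
  exact ((isOpen_ne_fun (h 0) (h 1)).inter (isOpen_lt continuous_const (h 2))).measurableSet

theorem memLp_inv_det {S : Set S2}
    (hS : IntegrableOn (fun θ : S2 => (‖(matI θ).det‖ ^ 2)⁻¹) S surfaceMeasure) :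
    MemLp (fun θ : S2 => (matI θ).det⁻¹) 2 (surfaceMeasure.restrict S) := by
  have hm : Measurable fun θ : S2 => (matI θ).det⁻¹ := continuous_matI.matrix_det.measurable.inv
  refine (memLp_two_iff_integrable_sq_norm hm.aestronglyMeasurable).2 ?_
  simpa only [norm_inv, inv_pow] using! hS

end Families

/-! ### Polarisations, the determinant and the measured components. -/

section Algebra

theorem pol1_eq : pol1 = ![(1 - Complex.I) / 2, (1 + Complex.I) / 2, 0] := by
  have h2 : ((√2 : ℝ) : ℂ) ^ 2 = 2 := by exact_mod_cast Real.sq_sqrt (by norm_num : (0 : ℝ) ≤ 2)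
  ext i
  fin_cases i <;>
  simp [pol1, samplePol, jones, Matrix.mulVec, dotProduct, Matrix.mul_apply, Fin.sum_univ_three,
    Real.cos_pi_div_four, Real.sin_pi_div_four] <;> ring_nf <;> simp [h2] <;> ring

theorem pol2_eq : pol2 = ![(1 + Complex.I) / 2, (1 - Complex.I) / 2, 0] := by
  have h2 : ((√2 : ℝ) : ℂ) ^ 2 = 2 := by exact_mod_cast Real.sq_sqrt (by norm_num : (0 : ℝ) ≤ 2)
  ext i
  fin_cases i <;>
  simp [pol2, samplePol, jones, Matrix.mulVec, dotProduct, Matrix.mul_apply, Fin.sum_univ_three,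
    Real.cos_pi_div_four, Real.sin_pi_div_four] <;> ring_nf <;> simp [h2] <;> ring

theorem det_matI (θ : E3) :
    (matI θ).det = ((θ 1 : ℂ) - (θ 0 : ℂ)) * ((θ 0 : ℂ) ^ 2 + (θ 1 : ℂ) ^ 2 - 1) := by
  rw [Matrix.det_fin_three]
  simp [matI, rowI, pol1_eq, pol2_eq, proj]
  ring_nf
  simp [Complex.I_sq]
  ring

theorem sphere_sq_add (θ : S2) : (θ.1 0) ^ 2 + (θ.1 1) ^ 2 + (θ.1 2) ^ 2 = 1 := by
  have h : ‖θ.1‖ = 1 := by simp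
  have h2 := EuclideanSpace.real_norm_sq_eq θ.1
  rw [h, Fin.sum_univ_three] at h2
  linarith

/-- On the sphere the second factor of the determinant is `-θ₃²`. -/
theorem det_matI_ne_zero {θ : S2} (hθ : θ ∈ starDirections) : (matI θ).det ≠ 0 := by
  rw [det_matI]
  have h := sphere_sq_add θ
  refine mul_ne_zero (sub_ne_zero.2 fun h1 => hθ.1 ?_) fun h2 => ?_
  · exact_mod_cast h1.symm
  · have h3 : (θ.1 0) ^ 2 + (θ.1 1) ^ 2 - 1 = 0 := Complex.ofReal_injective (by push_cast; exact h2)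
    have := hθ.2
    nlinarith

variable {Ω : Set E3} {freq c : ℝ}

theorem rowI_sub (p q : Fin 3 → ℂ) (θ : E3) (k : Fin 3) :
    rowI (p - q) θ k = rowI p θ k - rowI q θ k := by
  ext i
  fin_cases i <;> simp [rowI] <;> ring

theorem rowL_sub (p q : Fin 3 → ℂ) (y : Fin 3 → E3 → ℂ) (θ : E3) (k : Fin 3) :
    rowL Ω freq c (p - q) y θ k = rowL Ω freq c p y θ k - rowL Ω freq c q y θ k := by
  simp only [rowL, Pi.sub_apply]
  ring

/-- In the first two columns each entry of the matrix product has two terms, so integrability is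
used to split the integral; the column of `s` has a single term. -/
theorem opK_orthoMatrix {y : Fin 3 → E3 → ℂ} {s : E3 → ℂ} {θ : E3}
    (hy : ∀ i j l, Integrable fun k => kernelZ Ω freq c θ k i j * y l k) (i : Fin 3) :
    opK Ω freq c (orthoMatrix y s) θ i =
      ![scalK Ω freq c i 0 (y 0) θ + scalK Ω freq c i 1 (y 1) θ,
        scalK Ω freq c i 0 (y 1) θ + scalK Ω freq c i 1 (y 2) θ,
        scalK Ω freq c i 2 s θ] := by
  ext j
  fin_cases j
  · simp [opK, scalK, Matrix.mul_apply, Fin.sum_univ_three, orthoMatrix]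
    exact integral_add (hy _ _ _) (hy _ _ _)
  · simp [opK, scalK, Matrix.mul_apply, Fin.sum_univ_three, orthoMatrix]
    exact integral_add (hy _ _ _) (hy _ _ _)
  · simp [opK, scalK, Matrix.mul_apply, Fin.sum_univ_three, orthoMatrix]

theorem opKdag_orthoMatrix {y : Fin 3 → E3 → ℂ} {s : E3 → ℂ} {θ : E3}
    (hy : ∀ i j l, Integrable fun k => kernelY Ω freq c θ k i j * y l k) (j : Fin 3) :
    (fun i => opKdag Ω freq c (orthoMatrix y s) θ i j) =
      ![scalKdag Ω freq c 0 j (y 0) θ + scalKdag Ω freq c 1 j (y 1) θ,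
        scalKdag Ω freq c 0 j (y 1) θ + scalKdag Ω freq c 1 j (y 2) θ,
        scalKdag Ω freq c 2 j s θ] := by
  ext i
  fin_cases i
  · simp [opKdag, scalKdag, Matrix.mul_apply, Fin.sum_univ_three, orthoMatrix]
    simp_rw [mul_comm (y _ _)]
    exact integral_add (hy _ _ _) (hy _ _ _)
  · simp [opKdag, scalKdag, Matrix.mul_apply, Fin.sum_univ_three, orthoMatrix]
    simp_rw [mul_comm (y _ _)]
    exact integral_add (hy _ _ _) (hy _ _ _)
  · simp [opKdag, scalKdag, Matrix.mul_apply, Fin.sum_univ_three, orthoMatrix]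
    simp_rw [mul_comm (s _)]

/-- The two observed components of the measurement for a polarisation `p` with `p₁ + p₂ = 1`
and `p₃ = 0`. -/
theorem proj_mulVec_matY {y : Fin 3 → E3 → ℂ} {s : E3 → ℂ} {θ : E3} (χ₀ : ℝ)
    (hZ : ∀ i j l, Integrable fun k => kernelZ Ω freq c θ k i j * y l k)
    (hY : ∀ i j l, Integrable fun k => kernelY Ω freq c θ k i j * y l k)
    {p : Fin 3 → ℂ} (hp : p 0 + p 1 = 1) (hp2 : p 2 = 0) (k : Fin 3) :
    (proj θ *ᵥ (matY Ω freq c χ₀ (orthoMatrix y s) θ *ᵥ p)) k =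
      rowI p θ k ⬝ᵥ (fun i => y i (obsFreq freq c θ)) + χ₀ * rowL Ω freq c p y θ k
        + χ₀ * rowM Ω freq c y θ k + proj θ k 2 * (χ₀ * opM Ω freq c 2 s θ) := by
  have hK := fun i j => congrFun (opK_orthoMatrix (s := s) hZ i) j
  have hD := fun i j => congrFun (opKdag_orthoMatrix (s := s) hY j) i
  -- Since `p₁ + p₂ = 1` and `p₃ = 0`, the background matrix maps `p` to `χ₀ (1, 1, 0)`; therefore
  -- the contribution of `𝒦†` does not depend on `p`.
  have hp1 : p 1 = 1 - p 0 := by rw [← hp]; ring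
  simp only [Matrix.mulVec, dotProduct, Fin.sum_univ_three, matY, Matrix.add_apply,
    Matrix.mul_apply, hK, hD, hp2, background, Matrix.smul_apply, orthoMatrix, rowI, rowL, rowM,
    opL, opM]
  simp
  rw [hp1]
  ring

end Algebra

/-! ### Elimination of the fourth unknown. -/

section Reduction

/-- The `M` and `s` terms agree for both polarisations and cancel in the differences. The first two
equations are recovered from their combinations with coefficients `(t1, -t0)` and `(t0, t1)`, a
system of determinant `t0² + t1²`. -/
theorem reduced_equations_iff {t0 t1 t2 χ D0 D1 I10 I11 I20 I21 L10 L11 L20 L21 M0 M1 s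
    b00 b01 b10 b11 : ℂ} (h2 : t2 ≠ 0) (hD : t0 ^ 2 + t1 ^ 2 ≠ 0) (hD0 : D0 = -(t0 * t2))
    (hD1 : D1 = -(t1 * t2)) :
    (I10 + χ * L10 + χ * M0 + D0 * s = b00 ∧ I11 + χ * L11 + χ * M1 + D1 * s = b01 ∧
      I20 + χ * L20 + χ * M0 + D0 * s = b10 ∧ I21 + χ * L21 + χ * M1 + D1 * s = -b11) ↔
    (((I10 - I20) + χ * (L10 - L20) = b00 - b10 ∧ (I11 - I21) + χ * (L11 - L21) = b01 + b11 ∧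
      (t1 * I10 - t0 * I11) + χ * (t1 * (L10 + M0) - t0 * (L11 + M1)) = t1 * b00 - t0 * b01) ∧
      s = -(t0 * (b00 - (I10 + χ * L10 + χ * M0)) + t1 * (b01 - (I11 + χ * L11 + χ * M1)))
        / (t2 * (t0 ^ 2 + t1 ^ 2))) := by
  subst hD0 hD1
  rw [eq_div_iff (mul_ne_zero h2 hD)]
  constructor
  · rintro ⟨e1, e2, e3, e4⟩
    refine ⟨⟨?_, ?_, ?_⟩, ?_⟩
    · linear_combination e1 - e3
    · linear_combination e2 - e4
    · linear_combination t1 * e1 - t0 * e2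
    · linear_combination -t0 * e1 - t1 * e2
  · rintro ⟨⟨f1, f2, f3⟩, f4⟩
    have e1 : I10 + χ * L10 + χ * M0 + -(t0 * t2) * s = b00 := by
      refine mul_left_cancel₀ hD ?_
      linear_combination t1 * f3 - t0 * f4
    have e2 : I11 + χ * L11 + χ * M1 + -(t1 * t2) * s = b01 := by
      refine mul_left_cancel₀ hD ?_
      linear_combination -t0 * f3 - t1 * f4
    exact ⟨e1, e2, by linear_combination e1 - f1, by linear_combination e2 - f2⟩

theorem add_inv_mulVec_eq_iff {A : Matrix (Fin 3) (Fin 3) ℂ} (hA : A.det ≠ 0)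
    (y n d : Fin 3 → ℂ) : y + A⁻¹ *ᵥ n = A⁻¹ *ᵥ d ↔ A *ᵥ y + n = d := by
  have hu : IsUnit A.det := isUnit_iff_ne_zero.2 hA
  constructor
  · intro h
    have h2 := congrArg (A *ᵥ ·) h
    simpa [Matrix.mulVec_add, Matrix.mulVec_mulVec, Matrix.mul_nonsing_inv A hu] using h2
  · rintro rfl
    simp [Matrix.mulVec_add, Matrix.mulVec_mulVec, Matrix.nonsing_inv_mul A hu]

variable {Ω : Set E3} {freq c : ℝ}

theorem reducedSystem_iff {θ : S2} (hθ : θ ∈ starDirections) (χ₀ : ℝ)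
    (m : Fin 2 → Fin 2 → S2 → ℂ) {y : Fin 3 → E3 → ℂ} {s : E3 → ℂ}
    (hZ : ∀ i j l, Integrable fun k => kernelZ Ω freq c θ k i j * y l k)
    (hY : ∀ i j l, Integrable fun k => kernelY Ω freq c θ k i j * y l k) :
    ReducedSystem Ω freq c χ₀ m y s θ ↔
      ((fun i => y i (obsFreq freq c θ)) + opC Ω freq c χ₀ y θ = rhsSecond m θ ∧
        (χ₀ : ℂ) * opM Ω freq c 2 s θ = rhsFirst Ω freq c χ₀ m y θ) := by
  have hs := sphere_sq_add θ
  have h2 : ((θ.1 2 : ℝ) : ℂ) ≠ 0 := by exact_mod_cast hθ.2.ne'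
  have hD : ((θ.1 0 : ℝ) : ℂ) ^ 2 + ((θ.1 1 : ℝ) : ℂ) ^ 2 ≠ 0 := by
    norm_cast
    -- If `θ₁² + θ₂² = 0`, both coordinates vanish and are therefore equal, which `starDirections`
    -- excludes.
    intro h
    refine hθ.1 ?_
    have h0 : θ.1 0 = 0 := by nlinarith [sq_nonneg (θ.1 0), sq_nonneg (θ.1 1)]
    have h1 : θ.1 1 = 0 := by nlinarith [sq_nonneg (θ.1 0), sq_nonneg (θ.1 1)]
    rw [h0, h1]
  have hp1 : pol1 0 + pol1 1 = 1 := by rw [pol1_eq]; simp; ring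
  have hp2 : pol2 0 + pol2 1 = 1 := by rw [pol2_eq]; simp; ring
  have hp12 : pol1 2 = 0 := by rw [pol1_eq]; simp
  have hp22 : pol2 2 = 0 := by rw [pol2_eq]; simp
  rw [opC, rhsSecond, add_inv_mulVec_eq_iff (det_matI_ne_zero hθ), ReducedSystem,
    proj_mulVec_matY χ₀ hZ hY hp1 hp12, proj_mulVec_matY χ₀ hZ hY hp1 hp12,
    proj_mulVec_matY χ₀ hZ hY hp2 hp22, proj_mulVec_matY χ₀ hZ hY hp2 hp22,
    reduced_equations_iff h2 hD (by simp [proj]) (by simp [proj])]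
  refine and_congr ?_ Iff.rfl
  rw [funext_iff, Fin.forall_fin_succ, Fin.forall_fin_succ, Fin.forall_fin_one]
  refine and_congr ?_ (and_congr ?_ ?_)
  · simp only [Pi.add_apply, Matrix.mulVec, matI, opN, dataTilde, Pi.smul_apply, smul_eq_mul,
      Matrix.cons_val_zero, rowI_sub, rowL_sub, sub_dotProduct]
  · change _ ↔ rowI (pol1 - pol2) θ 1 ⬝ᵥ _ + (χ₀ : ℂ) * rowL Ω freq c (pol1 - pol2) y θ 1 = _
    rw [rowI_sub, rowL_sub, sub_dotProduct]
    rfl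
  · change _ ↔ ((θ.1 1 : ℂ) • rowI pol1 θ 0 - (θ.1 0 : ℂ) • rowI pol1 θ 1) ⬝ᵥ _ + _ = _
    rw [sub_dotProduct, smul_dotProduct, smul_dotProduct]
    rfl

end Reduction

/-! ### The equivalence and the compactness statements. -/

theorem mainTheorem1 (Ω : Set E3) (hΩ : IsOpen Ω) (hΩb : Bornology.IsBounded Ω)
    (ω c χ₀ : ℝ) (hω : 0 < ω) (hc : 0 < c) :
    -- the matrix that has to be inverted is invertible in every admissible direction
    (∀ θ ∈ starDirections,
      (matI θ).det = ((θ.1 1 : ℂ) - (θ.1 0 : ℂ)) * ((θ.1 0 : ℂ) ^ 2 + (θ.1 1 : ℂ) ^ 2 - 1) ∧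
      (matI θ).det ≠ 0) ∧
    -- the reduced system is equivalent to the equation of the second kind for the first three
    -- unknowns together with the equation of the first kind for the fourth one
    (∀ (m : Fin 2 → Fin 2 → S2 → ℂ) (ψ : Fin 3 → Lp ℂ 2 (volume.restrict Ω))
      (ψ33 : Lp ℂ 2 (volume.restrict Ω)), ∀ θ ∈ starDirections,
      ReducedSystem Ω ω c χ₀ m (fun i => fourierOn Ω (ψ i)) (fourierOn Ω ψ33) θ ↔
        ((fun i => fourierOn Ω (ψ i) (obsFreq ω c θ))
            + opC Ω ω c χ₀ (fun i => fourierOn Ω (ψ i)) θ = rhsSecond m θ ∧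
          (χ₀ : ℂ) * opM Ω ω c 2 (fourierOn Ω ψ33) θ
            = rhsFirst Ω ω c χ₀ m (fun i => fourierOn Ω (ψ i)) θ)) ∧
    -- the operator of the second kind equation is compact on every admissible set of directions
    (∀ S : Set S2, MeasurableSet S → S ⊆ starDirections →
      IntegrableOn (fun θ : S2 => (‖(matI θ).det‖ ^ 2)⁻¹) S surfaceMeasure →
      ∃ T : (Fin 3 → Lp ℂ 2 (volume.restrict Ω)) →L[ℂ]
          (Fin 3 → Lp ℂ 2 (surfaceMeasure.restrict S)),
        IsCompactOperator T ∧
        ∀ (ψ : Fin 3 → Lp ℂ 2 (volume.restrict Ω)) (i : Fin 3),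
          T ψ i =ᵐ[surfaceMeasure.restrict S]
            fun θ => opC Ω ω c χ₀ (fun l => fourierOn Ω (ψ l)) θ i) ∧
    -- on the whole set of directions it is compact after multiplication with the determinant
    (∃ T : (Fin 3 → Lp ℂ 2 (volume.restrict Ω)) →L[ℂ]
          (Fin 3 → Lp ℂ 2 (surfaceMeasure.restrict starDirections)),
        IsCompactOperator T ∧
        ∀ (ψ : Fin 3 → Lp ℂ 2 (volume.restrict Ω)) (i : Fin 3),
          T ψ i =ᵐ[surfaceMeasure.restrict starDirections]
            fun θ => (matI θ).det * opC Ω ω c χ₀ (fun l => fourierOn Ω (ψ l)) θ i) ∧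
    -- the operator of the first kind equation is compact
    (∃ T : Lp ℂ 2 (volume.restrict Ω) →L[ℂ] Lp ℂ 2 surfaceMeasure,
        IsCompactOperator T ∧
        ∀ ψ33 : Lp ℂ 2 (volume.restrict Ω),
          T ψ33 =ᵐ[surfaceMeasure] fun θ => opM Ω ω c 2 (fourierOn Ω ψ33) θ) := by
  refine ⟨fun θ hθ => ⟨det_matI θ, det_matI_ne_zero hθ⟩, ?_, ?_, ?_, ?_⟩
  · intro m ψ ψ33 θ hθ
    exact reducedSystem_iff hθ χ₀ m
      (fun i j l => integrable_kernelZ_mul hΩ hΩb i j (ψ l) θ)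
      (fun i j l => integrable_kernelY_mul hΩ hΩb i j (ψ l) θ)
  · intro S _ _ hSi
    choose A hA using fun i =>
      isContinuousFamily_adjugate_mulVec (freq := ω) (c := c) hΩ hΩb χ₀ i
    -- The square integrable weight is `1 / det Ĩ`, and `A` represents `adj(Ĩ) 𝒩`.
    obtain ⟨T, hT, hTA⟩ := exists_isCompactOperator_of_families _ (memLp_inv_det hSi) A
    refine ⟨T, hT, fun ψ i => (hTA ψ i).trans (Filter.Eventually.of_forall fun θ => ?_)⟩
    simp only [opC_eq, ← hA]
  · choose A hA using fun i =>
      isContinuousFamily_adjugate_mulVec (freq := ω) (c := c) hΩ hΩb χ₀ i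
    -- The determinant cancels its inverse, so the operator is `adj(Ĩ) 𝒩` and the weight `1`
    -- suffices.
    obtain ⟨T, hT, hTA⟩ := exists_isCompactOperator_of_families
      (surfaceMeasure.restrict starDirections) (memLp_const (1 : ℂ)) A
    refine ⟨T, hT, fun ψ i => (hTA ψ i).trans ?_⟩
    filter_upwards [ae_restrict_mem measurableSet_starDirections] with θ hθ
    rw [opC_eq, ← hA, mul_inv_cancel_left₀ (det_matI_ne_zero hθ), one_mul]
  · obtain ⟨A, hA⟩ := isContinuousFamily_opM (freq := ω) (c := c) hΩ hΩb 2
      (ContinuousLinearMap.id ℂ (Lp ℂ 2 ((volume : Measure E3).restrict Ω)))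
    obtain ⟨T, hT, hTA⟩ := exists_isCompactOperator_of_family surfaceMeasure
      (memLp_const (1 : ℂ)) A
    refine ⟨T, hT, fun ψ => (hTA ψ).trans (Filter.Eventually.of_forall fun θ => ?_)⟩
    simp only [one_mul, ← hA]
    rfl
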